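/- **Setting.** For a bounded measurable random loss $Z$ on a probability space $(\mathcal S,P)$ let $$\mathrm{CVaR}_\alpha(Z;P)=\sup\Big\{\mathbb E_Q Z : Q\ll P,\ \tfrac{dQ}{dP}\le \tfrac1\alpha\Big\}\quad(0<\alpha\le1),\qquad \mathrm{Pen}_\lambda(Z;P)=\sup_{Q\ll P}\Big\{\mathbb E_Q Z-\lambda D_{\chi^2}(Q,P)\Big\},\quad \lambda>0,$$ where $Q$ ranges over probability distributions and $D_{\chi^2}(Q,P)=\frac12\int(\frac{dQ}{dP}-1)^2\,dP$. For a loss $\ell:\mathcal X\times\mathcal S\to\mathbb R$ and a distribution $P_0$ on $\mathcal S$ write $\mathcal L_{\mathrm{CVaR}}(x;P_0)=\mathrm{CVaR}_\alpha(\ell(x;\cdot);P_0)$ and $\mathcal L_{\chi^2\text{-pen}}(x;P_0)=\mathrm{Pen}_\lambda(\ell(x;\cdot);P_0)$. In the stochastic first-order oracle model, a (possibly randomized) algorithm successively chooses queries $x_0,x_1,\dots\in\mathcal X$, where $x_t$ depends on the algorithm's random seed and on the answers to the first $t$ queries; the answer to $x_t$ is $(\ell(x_t;S_t),\nabla\ell(x_t;S_t))$,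 where $S_0,S_1,\dots$ are i.i.d. from $P_0$ and independent of the seed, and $\nabla\ell(x;s)$ is a subgradient of $\ell(\cdot;s)$ at $x$. Thus $x_T$ is the point produced after $T$ queries. A distribution is of Bernoulli type if it charges at most two points. **Theorem (minimax lower bounds).** There are numerical constants $c,C>0$ such that for all $G,R>0$ and $\epsilon\in(0,GR/64)$ the following holds. 1. (CVaR, every dimension.) Let $\alpha\in(0,1]$, $d\ge1$, $\mathcal X=\{x\in\mathbb R^d:\|x\|\le R\}$ and $\mathcal S=[-1,1]$. There is a loss $\ell:\mathcal X\times\mathcal S\to[0,GR]$, convex and $G$-Lipschitz in $x$, such that for every choice of subgradients $\nabla\ell$, every integer $T\ge 0$ with $T\le c\,\frac{(GR)^2}{\alpha\epsilon^2}$ and every algorithm, there is a Bernoulli-type distribution $P_0$ on $\mathcal S$ with $$\mathbb E\big[\mathcal L_{\mathrm{CVaR}}(x_T;P_0)\big]-\inf_{x'\in\mathcal X}\mathcal L_{\mathrm{CVaR}}(x';P_0)>\epsilon .$$ 2. (CVaR, dimension one, samples fully observed.) Let $\alpha\in(0,1]$, $\mathcal S=[-G,G]$, $\mathcal X=[-R,R]$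 and $\ell(x;s)=x\cdot s$. For every integer $n\ge 0$ with $n\le\frac{(GR)^2}{2048\,\alpha\epsilon^2}$ and every (possibly randomized) map $\hat x_n:\mathcal S^n\to\mathcal X$ there is a Bernoulli-type distribution $P_0$ on $\mathcal S$ such that, for $S_1,\dots,S_n$ i.i.d. from $P_0$ and independent of the randomization, $$\mathbb E\big[\mathcal L_{\mathrm{CVaR}}(\hat x_n(S_1^n);P_0)\big]-\inf_{x'\in\mathcal X}\mathcal L_{\mathrm{CVaR}}(x';P_0)>\epsilon .$$ 3. (Penalized $\chi^2$.) There is a dimension $d_\epsilon\le C\,\frac{(GR)^2}{\epsilon^2}\log\frac{GR}{\epsilon}$, depending only on $G,R,\epsilon$, such that for $\mathcal X=\{x\in\mathbb R^{d_\epsilon}:\|x\|\le R\}$ and $\mathcal S=[-1,1]$: for every $\lambda>0$, every integer $T\ge0$ with $T\le c\,\frac{(GR)^2}{(\lambda/(GR))\,\epsilon^2}=c\,\frac{(GR)^3}{\lambda\epsilon^2}$ and every algorithm, there are a distribution $P_0$ on $\mathcal S$, a loss $\ell:\mathcal X\times\mathcal S\to[0,GR]$, convex and $G$-Lipschitz in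 $x$, and a choice of subgradients $\nabla\ell$ with $\|\nabla\ell\|\le G$, for which $$\mathbb E\big[\mathcal L_{\chi^2\text{-pen}}(x_T;P_0)\big]-\inf_{x'\in\mathcal X}\mathcal L_{\chi^2\text{-pen}}(x';P_0)>\epsilon .$$ -/

import Mathlib

open MeasureTheory Set

universe u

noncomputable section

/-- Euclidean space of dimension `d`. -/
abbrev Eucl (d : ℕ) : Type := EuclideanSpace ℝ (Fin d)

/-- The domain: the closed Euclidean ball of radius `R` in dimension `d`. -/
abbrev Dom (d : ℕ) (R : ℝ) : Type := Metric.closedBall (0 : Eucl d) R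

/-- The sample space `[-1, 1]`. -/
abbrev Sample : Type := Icc (-1 : ℝ) 1

section Objectives

variable {S : Type*} [MeasurableSpace S]

/-- Conditional value at risk at level `α` of the random loss `Z` under `P`: the largest
expectation of `Z` over the distributions whose likelihood ratio to `P` is at most `1 / α`. -/
def cvar (α : ℝ) (P : Measure S) (Z : S → ℝ) : ℝ :=
  sSup {v : ℝ | ∃ Q : Measure S, IsProbabilityMeasure Q ∧ Q ≪ P ∧
    (∀ᵐ s ∂P, Q.rnDeriv P s ≤ ENNReal.ofReal (1 / α)) ∧ v = ∫ s, Z s ∂Q}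

/-- The divergence `D(Q, P) = (1/2) ∫ (dQ/dP - 1)² dP`, for `Q ≪ P`, possibly infinite. -/
def chiSqDiv (Q P : Measure S) : ENNReal :=
  2⁻¹ * ∫⁻ s, ENNReal.ofReal (((Q.rnDeriv P s).toReal - 1) ^ 2) ∂P

/-- The penalized `χ²` objective `sup_Q {E_Q Z - lam * D(Q, P)}`, where `lam > 0`.
Distributions with infinite divergence have the value `-∞` and do not contribute. -/
def chiSqPen (lam : ℝ) (P : Measure S) (Z : S → ℝ) : ℝ :=
  sSup {v : ℝ | ∃ Q : Measure S, IsProbabilityMeasure Q ∧ Q ≪ P ∧ chiSqDiv Q P ≠ ⊤ ∧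
    v = ∫ s, Z s ∂Q - lam * (chiSqDiv Q P).toReal}

/-- `P` is a Bernoulli-type distribution: it charges at most two points. -/
def IsTwoPoint (P : Measure S) : Prop :=
  ∃ (p : ℝ) (a b : S), 0 ≤ p ∧ p ≤ 1 ∧
    P = ENNReal.ofReal p • Measure.dirac a + ENNReal.ofReal (1 - p) • Measure.dirac b

end Objectives

section Losses

variable {S : Type*} [MeasurableSpace S] {d : ℕ}

/-- `ℓ` is a (measurable) loss on the ball of radius `R`, with values in `[0, G R]`,
convex and `G`-Lipschitz in its first argument.  Values of `ℓ` off the ball play no role. -/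
structure IsLoss (G R : ℝ) (ℓ : Eucl d → S → ℝ) : Prop where
  measurable : Measurable fun p : Dom d R × S => ℓ p.1 p.2
  convex : ∀ s, ConvexOn ℝ (Metric.closedBall (0 : Eucl d) R) fun x => ℓ x s
  lipschitz : ∀ s, ∀ x ∈ Metric.closedBall (0 : Eucl d) R,
    ∀ y ∈ Metric.closedBall (0 : Eucl d) R, |ℓ x s - ℓ y s| ≤ G * ‖x - y‖
  mem_Icc : ∀ s, ∀ x ∈ Metric.closedBall (0 : Eucl d) R, ℓ x s ∈ Icc 0 (G * R)

/-- `g x s` is a (measurable) choice of a subgradient at `x` of the convex function `ℓ(·; s)`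
on the ball of radius `R`. -/
structure IsSubgradient (R : ℝ) (ℓ : Eucl d → S → ℝ) (g : Eucl d → S → Eucl d) : Prop where
  measurable : Measurable fun p : Dom d R × S => g p.1 p.2
  le : ∀ s, ∀ x ∈ Metric.closedBall (0 : Eucl d) R,
    ∀ y ∈ Metric.closedBall (0 : Eucl d) R, ℓ x s + inner ℝ (g x s) (y - x) ≤ ℓ y s

/-- The stochastic first-order oracle: the answer `(ℓ(x; s), ∇ℓ(x; s))` to the query `x` when the
sample drawn is `s`. -/
def firstOrderOracle {R : ℝ} (ℓ : Eucl d → S → ℝ) (g : Eucl d → S → Eucl d)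
    (x : Dom d R) (s : S) : ℝ × Eucl d :=
  (ℓ x s, g x s)

end Losses

section Algorithms

/-- A randomized algorithm with random seed in `Ξ`, queries in `X` and oracle answers in `Y`:
the point `point t ξ h` is chosen from the seed `ξ` and the `t` answers `h` received so far.
(Earlier queries are functions of the seed and of earlier answers.) -/
structure Algorithm (Ξ X Y : Type*) [MeasurableSpace Ξ] [MeasurableSpace X]
    [MeasurableSpace Y] where
  point : (t : ℕ) → Ξ → (Fin t → Y) → X
  measurable_point : ∀ t, Measurable fun p : Ξ × (Fin t → Y) => point t p.1 p.2

variable {Ξ X Y S : Type*} [MeasurableSpace Ξ] [MeasurableSpace X] [MeasurableSpace Y]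

/-- The answers to the first `t` queries, when the algorithm interacts with the oracle `O` and
the samples drawn in the successive rounds are `s 0, …, s (t - 1)`. -/
def Algorithm.answers (A : Algorithm Ξ X Y) (O : X → S → Y) (ξ : Ξ) :
    (t : ℕ) → (Fin t → S) → (Fin t → Y)
  | 0, _ => fun i => i.elim0
  | t + 1, s =>
    Fin.snoc (α := fun _ => Y) (A.answers O ξ t (fun i => s i.castSucc))
      (O (A.point t ξ (A.answers O ξ t (fun i => s i.castSucc))) (s (Fin.last t)))

/-- The point `x_T` that the algorithm produces after `T` oracle queries. -/
def Algorithm.output (A : Algorithm Ξ X Y) (O : X → S → Y) (T : ℕ) (ω : Ξ × (Fin T → S)) : X :=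
  A.point T ω.1 (A.answers O ω.1 T ω.2)

/-- The random point `x` of `X` has a well-defined expected suboptimality for `F`, and it is
greater than `ε`. -/
def ExpectedGapGT {Ω : Type*} [MeasurableSpace Ω] (μ : Measure Ω) (F : X → ℝ) (x : Ω → X)
    (ε : ℝ) : Prop :=
  Integrable (fun ω => F (x ω)) μ ∧ ε < ∫ ω, F (x ω) ∂μ - ⨅ x' : X, F x'

end Algorithms

end

/-! Both objectives can concentrate on a rare atom, while samples reveal little about it.

CVaR: let the atom `a` have mass `α u` with `u = 1/2 ± δ`. Likelihood ratios up to `1/α` lift its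
mass to `u`. For a loss equal to `κ₀ + κ φ(x)` on `a` and `κ₀ - κ φ(x)` on `b`, the objective is
then governed by `(2u - 1) κ φ(x)`: one sign of the bias penalizes positive `φ`, the other rewards
`φ = R`, so no point is good for both. But the two laws differ in a mass of order `α δ` on an atom
of mass of order `α`, a `χ²` distance of order `α δ²` per sample. With `δ` of order `ε/(GR)`, order
`(GR)²/(α ε²)` samples are needed to tell them apart (`cvar_twoPoint`, `sum_bernoulliWeight_sub_lt`,
`exists_twoPoint_cvar_gap`).

Penalized `χ²`: the sample `1` has mass `p` of order `min(1, λ/(GR))` and carries a hard convex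
function; at the other sample the loss is zero. The penalty is cheap enough that the best `Q` is the
point mass at `1` (`chiSqPen_twoPoint`), so the objective is that function up to a constant, while
only about `T p` answers are informative. The function is a maximum of `N` linear forms supported on
disjoint blocks of `m` coordinates with unknown signs. Its minimum over the ball is `-R/√N`, and a
fixed point reaches half that depth for at most a fraction `exp(-Nm/8)` of the sign patterns
(`card_filter_inner_signVec_lt`). An informative answer has at most `N 2^m ≤ exp(2m)` values, so `K
≤ N/32` of them cannot beat a union bound over transcripts (`Algorithm.exists_finset_answers`,
`card_filter_output_le`). Averaging over signs yields a pattern missed with probability at least one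
half; `N` of order `(GR/ε)²` makes the resulting gap exceed `ε`. -/

noncomputable section

/-! ### Both robust objectives on two-point distributions. -/

section TwoPoint

variable {S : Type*} [MeasurableSpace S]

/-- The distribution giving mass `p` to `a` and mass `1 - p` to `b`. -/
def twoPoint (p : ℝ) (a b : S) : Measure S :=
  ENNReal.ofReal p • Measure.dirac a + ENNReal.ofReal (1 - p) • Measure.dirac b

lemma isTwoPoint_twoPoint {p : ℝ} (h0 : 0 ≤ p) (h1 : p ≤ 1) (a b : S) :
    IsTwoPoint (twoPoint p a b) :=
  ⟨p, a, b, h0, h1, rfl⟩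

lemma isProbabilityMeasure_twoPoint {p : ℝ} (h0 : 0 ≤ p) (h1 : p ≤ 1) (a b : S) :
    IsProbabilityMeasure (twoPoint p a b) := by
  constructor
  simp only [twoPoint, Measure.add_apply, Measure.smul_apply, measure_univ, smul_eq_mul, mul_one]
  rw [← ENNReal.ofReal_add h0 (by linarith)]
  simp

lemma map_twoPoint {S' : Type*} [MeasurableSpace S'] {f : S → S'} (hf : Measurable f) (p : ℝ)
    (a b : S) : (twoPoint p a b).map f = twoPoint p (f a) (f b) := by
  simp [twoPoint, Measure.map_add _ _ hf, Measure.map_smul, Measure.map_dirac' hf]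

variable [MeasurableSingletonClass S]

lemma lintegral_twoPoint (p : ℝ) (a b : S) (f : S → ENNReal) :
    ∫⁻ s, f s ∂(twoPoint p a b) = ENNReal.ofReal p * f a + ENNReal.ofReal (1 - p) * f b := by
  simp [twoPoint, lintegral_add_measure, lintegral_smul_measure, lintegral_dirac]

lemma integral_twoPoint {p : ℝ} (h0 : 0 ≤ p) (h1 : p ≤ 1) (a b : S) (f : S → ℝ) :
    ∫ s, f s ∂(twoPoint p a b) = p * f a + (1 - p) * f b := by
  have hi : ∀ (c : S), Integrable f (Measure.dirac c) := fun c => integrable_dirac (by simp)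
  rw [twoPoint, integral_add_measure ((hi a).smul_measure (by simp))
    ((hi b).smul_measure (by simp)), integral_smul_measure, integral_smul_measure,
    integral_dirac, integral_dirac, ENNReal.toReal_ofReal h0,
    ENNReal.toReal_ofReal (by linarith), smul_eq_mul, smul_eq_mul]

/-- Both atoms have positive mass, so an almost-everywhere bound on a density becomes a bound at
each atom. -/
lemma ae_twoPoint_iff {p : ℝ} (h0 : 0 < p) (h1 : p < 1) (a b : S) (q : S → Prop) :
    (∀ᵐ s ∂(twoPoint p a b), q s) ↔ q a ∧ q b := by
  rw [twoPoint, ae_add_measure_iff, Measure.ae_ennreal_smul_measure_iff (by simpa using h0),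
    Measure.ae_ennreal_smul_measure_iff (by simpa using h1), ae_dirac_eq, ae_dirac_eq]
  simp

lemma integral_eq_of_absolutelyContinuous_twoPoint {p : ℝ} (h0 : 0 ≤ p) (h1 : p ≤ 1) {a b : S}
    {Q : Measure S} [IsProbabilityMeasure Q] (hQ : Q ≪ twoPoint p a b) (Z : S → ℝ) :
    ∫ s, Z s ∂Q = p * ((Q.rnDeriv (twoPoint p a b) a).toReal * Z a)
      + (1 - p) * ((Q.rnDeriv (twoPoint p a b) b).toReal * Z b) := by
  have := isProbabilityMeasure_twoPoint h0 h1 a b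
  rw [← integral_rnDeriv_smul hQ, integral_twoPoint h0 h1]
  simp

lemma rnDeriv_twoPoint_sum {p : ℝ} (h0 : 0 ≤ p) (h1 : p ≤ 1) {a b : S}
    {Q : Measure S} [IsProbabilityMeasure Q] (hQ : Q ≪ twoPoint p a b) :
    p * (Q.rnDeriv (twoPoint p a b) a).toReal
      + (1 - p) * (Q.rnDeriv (twoPoint p a b) b).toReal = 1 := by
  simpa using (integral_eq_of_absolutelyContinuous_twoPoint h0 h1 hQ (fun _ => 1)).symm

lemma toReal_chiSqDiv_twoPoint {p : ℝ} (h0 : 0 ≤ p) (h1 : p ≤ 1) (a b : S) (Q : Measure S) :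
    (chiSqDiv Q (twoPoint p a b)).toReal =
      (p * ((Q.rnDeriv (twoPoint p a b) a).toReal - 1) ^ 2
        + (1 - p) * ((Q.rnDeriv (twoPoint p a b) b).toReal - 1) ^ 2) / 2 := by
  have h1' : 0 ≤ 1 - p := by linarith
  rw [chiSqDiv, lintegral_twoPoint, ← ENNReal.ofReal_mul h0, ← ENNReal.ofReal_mul h1',
    ← ENNReal.ofReal_add (by positivity) (by positivity), ENNReal.toReal_mul,
    ENNReal.toReal_ofReal (by positivity)]
  simp
  ring

/-- Every pair of nonnegative likelihood ratios of mean one comes from a distribution. -/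
lemma exists_density_twoPoint {p : ℝ} (h0 : 0 ≤ p) (h1 : p ≤ 1) {a b : S} (hab : a ≠ b)
    {x y : ℝ} (hx : 0 ≤ x) (hy : 0 ≤ y) (hxy : p * x + (1 - p) * y = 1) :
    ∃ Q : Measure S, IsProbabilityMeasure Q ∧ Q ≪ twoPoint p a b ∧
      ∃ r : S → ℝ, r a = x ∧ r b = y ∧
        Q.rnDeriv (twoPoint p a b) =ᵐ[twoPoint p a b] fun s => ENNReal.ofReal (r s) := by
  classical
  have := isProbabilityMeasure_twoPoint h0 h1 a b
  have h1' : 0 ≤ 1 - p := by linarith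
  let r : S → ℝ := fun s => if s = a then x else y
  have hr : Measurable fun s => ENNReal.ofReal (r s) :=
    (Measurable.ite (measurableSet_singleton a) measurable_const measurable_const).ennreal_ofReal
  refine ⟨(twoPoint p a b).withDensity fun s => ENNReal.ofReal (r s), ⟨?_⟩,
    withDensity_absolutelyContinuous _ _, r, by simp [r], by simp [r, hab.symm],
    Measure.rnDeriv_withDensity _ hr⟩
  rw [withDensity_apply _ MeasurableSet.univ, Measure.restrict_univ, lintegral_twoPoint]
  simp only [r, if_true, hab.symm, if_false]
  rw [← ENNReal.ofReal_mul h0, ← ENNReal.ofReal_mul h1',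
    ← ENNReal.ofReal_add (by positivity) (by positivity), hxy, ENNReal.ofReal_one]

/-- On a two-point distribution whose first atom has mass `α u`, the conditional value at risk is
the larger of the two extreme expectations. -/
lemma cvar_twoPoint {α u : ℝ} (hα : 0 < α) (hα1 : α ≤ 1) (hu : 0 < u) (hu1 : u < 1) {a b : S}
    (hab : a ≠ b) (Z : S → ℝ) :
    cvar α (twoPoint (α * u) a b) Z =
      max (Z b + u * (Z a - Z b)) (Z b + max 0 (1 + u - 1 / α) * (Z a - Z b)) := by
  have hp0 : 0 < α * u := by positivity
  have hp1 : α * u < 1 := by nlinarith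
  have hq0 : 0 < 1 - α * u := by linarith
  have h1α : 1 ≤ 1 / α := by rw [le_div_iff₀ hα]; linarith
  -- Here `v` is the mass `Q` gives to `a`. The ratio bound at `a` says `v ≤ u`; the one at `b` says
  -- `1 - v ≤ 1/α - u`.
  have key : ∀ v, max 0 (1 + u - 1 / α) ≤ v → v ≤ u →
      ∃ Q : Measure S, IsProbabilityMeasure Q ∧ Q ≪ twoPoint (α * u) a b ∧
      (∀ᵐ s ∂(twoPoint (α * u) a b),
        Q.rnDeriv (twoPoint (α * u) a b) s ≤ ENNReal.ofReal (1 / α)) ∧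
      Z b + v * (Z a - Z b) = ∫ s, Z s ∂Q := by
    intro v hv hvu
    have hv0 : 0 ≤ v := (le_max_left _ _).trans hv
    have hv1 : 1 + u - 1 / α ≤ v := (le_max_right _ _).trans hv
    have hx : 0 ≤ v / (α * u) := by positivity
    have hy : 0 ≤ (1 - v) / (1 - α * u) := div_nonneg (by linarith) hq0.le
    have hsum : α * u * (v / (α * u)) + (1 - α * u) * ((1 - v) / (1 - α * u)) = 1 := by
      field_simp; ring
    obtain ⟨Q, hQ, hQP, r, hra, hrb, hr⟩ :=
      exists_density_twoPoint hp0.le hp1.le hab hx hy hsum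
    have hr' := (ae_twoPoint_iff hp0 hp1 a b _).1 hr
    simp only [hra, hrb] at hr'
    refine ⟨Q, hQ, hQP, (ae_twoPoint_iff hp0 hp1 a b _).2 ⟨?_, ?_⟩, ?_⟩
    · rw [hr'.1]
      apply ENNReal.ofReal_le_ofReal
      rw [div_le_div_iff₀ hp0 hα]
      nlinarith
    · rw [hr'.2]
      apply ENNReal.ofReal_le_ofReal
      rw [div_le_iff₀ hq0]
      have : 1 / α * (1 - α * u) = 1 / α - u := by field_simp
      linarith
    · rw [integral_eq_of_absolutelyContinuous_twoPoint hp0.le hp1.le hQP, hr'.1, hr'.2,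
        ENNReal.toReal_ofReal hx, ENNReal.toReal_ofReal hy]
      field_simp
      ring
  have hlow : max 0 (1 + u - 1 / α) ≤ u := max_le hu.le (by linarith)
  apply IsGreatest.csSup_eq
  constructor
  · rcases max_choice (Z b + u * (Z a - Z b)) (Z b + max 0 (1 + u - 1 / α) * (Z a - Z b))
      with h | h <;> rw [h]
    · exact key u hlow le_rfl
    · exact key _ le_rfl hlow
  · rintro v ⟨Q, hQ, hQP, hr, rfl⟩
    have hsum := rnDeriv_twoPoint_sum hp0.le hp1.le hQP
    have hr' := (ae_twoPoint_iff hp0 hp1 a b _).1 hr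
    rw [integral_eq_of_absolutelyContinuous_twoPoint hp0.le hp1.le hQP]
    have ha := ENNReal.toReal_mono ENNReal.ofReal_ne_top hr'.1
    have hb := ENNReal.toReal_mono ENNReal.ofReal_ne_top hr'.2
    rw [ENNReal.toReal_ofReal (by positivity)] at ha hb
    have ha0 := ENNReal.toReal_nonneg (a := Q.rnDeriv (twoPoint (α * u) a b) a)
    set x := (Q.rnDeriv (twoPoint (α * u) a b) a).toReal
    set y := (Q.rnDeriv (twoPoint (α * u) a b) b).toReal
    have hvu : α * u * x ≤ u := by
      calc α * u * x ≤ α * u * (1 / α) := by gcongr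
        _ = u := by field_simp
    have hvl : max 0 (1 + u - 1 / α) ≤ α * u * x := by
      apply max_le (by positivity)
      have : (1 - α * u) * y ≤ (1 - α * u) * (1 / α) := by gcongr
      have h2 : (1 - α * u) * (1 / α) = 1 / α - u := by field_simp
      linarith
    -- The expectation is affine in the mass of `a`, so it is largest at an end of the admissible
    -- interval.
    have hval : α * u * (x * Z a) + (1 - α * u) * (y * Z b)
        = Z b + (α * u * x) * (Z a - Z b) := by
      linear_combination Z b * hsum
    rw [hval]
    rcases le_total 0 (Z a - Z b) with h | h
    · exact le_max_of_le_left (by gcongr)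
    · exact le_max_of_le_right (by nlinarith)

/-- If `Z` is large on the first atom and vanishes on the second, then the penalized objective is
attained by the point mass at the first atom. -/
lemma chiSqPen_twoPoint {lam p : ℝ} (hlam : 0 < lam) (hp0 : 0 < p) (hp1 : p ≤ 1) {a b : S}
    (hab : a ≠ b) {Z : S → ℝ} (hb : Z b = 0) (ha : p = 1 ∨ lam / p ≤ Z a) :
    chiSqPen lam (twoPoint p a b) Z = Z a - lam * (1 - p) / (2 * p) := by
  have hq0 : 0 ≤ 1 - p := by linarith
  apply IsGreatest.csSup_eq
  constructor
  -- Ratios `1/p` and `0` describe the point mass at `a`.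
  · obtain ⟨Q, hQ, hQP, r, hra, hrb, hr⟩ := exists_density_twoPoint hp0.le hp1 hab
      (x := 1 / p) (y := 0) (by positivity) le_rfl (by field_simp; ring)
    have hdiv : chiSqDiv Q (twoPoint p a b) = ENNReal.ofReal ((1 - p) / (2 * p)) := by
      -- When `p = 1` the atom `b` is null, so the density is known there only up to a null set and
      -- is replaced under the integral.
      have : ∫⁻ s, ENNReal.ofReal (((Q.rnDeriv (twoPoint p a b) s).toReal - 1) ^ 2)
          ∂(twoPoint p a b) = ∫⁻ s, ENNReal.ofReal (((ENNReal.ofReal (r s)).toReal - 1) ^ 2)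
          ∂(twoPoint p a b) :=
        lintegral_congr_ae (by filter_upwards [hr] with s hs; rw [hs])
      rw [chiSqDiv, this, lintegral_twoPoint, hra, hrb, ENNReal.toReal_ofReal (by positivity),
        ← ENNReal.ofReal_mul hp0.le, ← ENNReal.ofReal_mul hq0,
        ← ENNReal.ofReal_add (by positivity) (by positivity),
        show (2⁻¹ : ENNReal) = ENNReal.ofReal (2⁻¹) by
          rw [ENNReal.ofReal_inv_of_pos (by norm_num)]; simp,
        ← ENNReal.ofReal_mul (by norm_num)]
      congr 1
      simp
      field_simp
      ring
    refine ⟨Q, hQ, hQP, by simp [hdiv], ?_⟩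
    have hi : ∫ s, Z s ∂Q = Z a := by
      have := isProbabilityMeasure_twoPoint hp0.le hp1 a b
      rw [← integral_rnDeriv_smul hQP]
      have h2 : ∫ s, (Q.rnDeriv (twoPoint p a b) s).toReal • Z s ∂(twoPoint p a b)
          = ∫ s, (ENNReal.ofReal (r s)).toReal • Z s ∂(twoPoint p a b) :=
        integral_congr_ae (by filter_upwards [hr] with s hs; rw [hs])
      rw [h2, integral_twoPoint hp0.le hp1, hra, hrb, hb, ENNReal.toReal_ofReal (by positivity)]
      simp
      field_simp
    rw [hi, hdiv, ENNReal.toReal_ofReal (by positivity)]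
    ring
  · rintro v ⟨Q, hQ, hQP, -, rfl⟩
    have hsum := rnDeriv_twoPoint_sum hp0.le hp1 hQP
    rw [integral_eq_of_absolutelyContinuous_twoPoint hp0.le hp1 hQP,
      toReal_chiSqDiv_twoPoint hp0.le hp1, hb]
    have hy0 := ENNReal.toReal_nonneg (a := Q.rnDeriv (twoPoint p a b) b)
    set x := (Q.rnDeriv (twoPoint p a b) a).toReal
    set y := (Q.rnDeriv (twoPoint p a b) b).toReal
    rcases ha with rfl | ha
    · have hx : x = 1 := by linarith
      simp [hx]
    · have h1 : (1 - p * x) * (lam / p) ≤ (1 - p * x) * Z a := by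
        apply mul_le_mul_of_nonneg_left ha
        nlinarith
      -- The convex divergence lies above its tangent at the point mass. The slope of this tangent,
      -- after multiplication by `lam / 2`, is the threshold `lam / p`: below it, moving mass off
      -- `a` would pay.
      have h2 : p * (x - 1) ^ 2 + (1 - p) * (y - 1) ^ 2 ≥ (1 - p) / p + 2 * (p * x - 1) / p := by
        have e : p * (x - 1) ^ 2 + (1 - p) * (y - 1) ^ 2 - ((1 - p) / p + 2 * (p * x - 1) / p)
            = p * (x - 1 / p) ^ 2 + (1 - p) * y ^ 2 := by
          have hy : (1 - p) * y = 1 - p * x := by linarith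
          have : (1 - p) * (y - 1) ^ 2 = (1 - p) * y ^ 2 - 2 * (1 - p * x) + (1 - p) := by
            linear_combination (-2) * hy
          rw [this]
          field_simp
          ring
        have : 0 ≤ p * (x - 1 / p) ^ 2 + (1 - p) * y ^ 2 := by positivity
        linarith
      have h3 : lam * ((p * (x - 1) ^ 2 + (1 - p) * (y - 1) ^ 2) / 2)
          ≥ lam * (((1 - p) / p + 2 * (p * x - 1) / p) / 2) := by gcongr
      have h4 : lam * (((1 - p) / p + 2 * (p * x - 1) / p) / 2)
          = lam * (1 - p) / (2 * p) - (1 - p * x) * (lam / p) := by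
        field_simp; ring
      nlinarith

end TwoPoint

/-! ### Two-point testing and the resulting bound for CVaR. -/

section Testing

/-- The probability that a Bernoulli variable of parameter `p` takes the value `t`. -/
def bernoulliWeight (p : ℝ) (t : Bool) : ℝ := cond t p (1 - p)

lemma sum_prod_bernoulliWeight (p : ℝ) (n : ℕ) :
    ∑ β : Fin n → Bool, ∏ i, bernoulliWeight p (β i) = 1 := by
  have := Fintype.sum_pow (bernoulliWeight p) n
  rw [← this]
  simp [bernoulliWeight]

lemma bernoulliWeight_pos {p : ℝ} (h0 : 0 < p) (h1 : p < 1) (t : Bool) :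
    0 < bernoulliWeight p t := by
  cases t <;> simp [bernoulliWeight, h0, h1]

/-- Two product Bernoulli distributions that are close in the `χ²` sense give close expectations
to a function with values in `[0, 1]`. -/
lemma sum_bernoulliWeight_sub_lt {p q : ℝ} (hp0 : 0 < p) (hp1 : p < 1) (hq0 : 0 < q) (hq1 : q < 1)
    {n : ℕ} (hn : n * ((p - q) ^ 2 / (q * (1 - q))) ≤ 1 / 9) {Φ : (Fin n → Bool) → ℝ}
    (h0 : ∀ β, 0 ≤ Φ β) (h1 : ∀ β, Φ β ≤ 1) :
    ∑ β, (∏ i, bernoulliWeight q (β i)) * Φ β - ∑ β, (∏ i, bernoulliWeight p (β i)) * Φ β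
      < 1 / 2 := by
  have hq1' : 0 < 1 - q := by linarith
  set w : ℝ → (Fin n → Bool) → ℝ := fun p β => ∏ i, bernoulliWeight p (β i) with hw
  have hwq : ∀ β, 0 < w q β := fun β => Finset.prod_pos fun i _ => bernoulliWeight_pos hq0 hq1 _
  set χ := (p - q) ^ 2 / (q * (1 - q)) with hχ
  have hχ0 : 0 ≤ χ := by positivity
  -- The second moment of the likelihood ratio is multiplicative over independent samples.
  have hratio : ∑ β, w p β ^ 2 / w q β = (1 + χ) ^ n := by
    have h := Fintype.sum_pow (fun t => bernoulliWeight p t ^ 2 / bernoulliWeight q t) n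
    have e : ∑ t, bernoulliWeight p t ^ 2 / bernoulliWeight q t = 1 + χ := by
      simp only [Fintype.sum_bool, bernoulliWeight, cond_true, cond_false, hχ]
      field_simp
      ring
    rw [← e, h]
    refine Finset.sum_congr rfl fun β _ => ?_
    simp only [hw]
    rw [Finset.prod_div_distrib, Finset.prod_pow]
  have hpow : (1 + χ) ^ n ≤ 1 + 2 / 9 := by
    have h3 : (1 + χ) ^ n ≤ Real.exp (n * χ) := by
      rw [Real.exp_nat_mul]
      exact pow_le_pow_left₀ (by positivity) (by linarith [Real.add_one_le_exp χ]) n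
    have h4 : 0 ≤ n * χ := by positivity
    have h5 := Real.abs_exp_sub_one_le (x := n * χ) (by rw [abs_of_nonneg h4]; linarith)
    rw [abs_of_nonneg h4] at h5
    linarith [le_abs_self (Real.exp (n * χ) - 1)]
  have hdiff : ∑ β, (w q β - w p β) ^ 2 / w q β = (1 + χ) ^ n - 1 := by
    have e : ∀ β, (w q β - w p β) ^ 2 / w q β = w q β - 2 * w p β + w p β ^ 2 / w q β := by
      intro β
      have := (hwq β).ne'
      field_simp
      ring
    simp only [e]
    rw [Finset.sum_add_distrib, Finset.sum_sub_distrib, hratio, ← Finset.mul_sum]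
    simp only [hw, sum_prod_bernoulliWeight]
    ring
  -- Cauchy–Schwarz with weight `w q`: the squared difference of expectations is at most the `χ²`
  -- distance, here at most `2/9 < 1/4`.
  have hcs := Finset.sum_sq_le_sum_mul_sum_of_sq_le_mul Finset.univ
    (r := fun β => (w q β - w p β) * Φ β) (f := fun β => (w q β - w p β) ^ 2 / w q β)
    (g := fun β => w q β * Φ β ^ 2)
    (fun β _ => div_nonneg (sq_nonneg _) (hwq β).le)
    (fun β _ => mul_nonneg (hwq β).le (sq_nonneg _))
    (fun β _ => le_of_eq (by have := (hwq β).ne'; field_simp))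
  have hg : ∑ β, w q β * Φ β ^ 2 ≤ 1 := by
    rw [← sum_prod_bernoulliWeight q n]
    refine Finset.sum_le_sum fun β _ => mul_le_of_le_one_right (hwq β).le ?_
    exact pow_le_one₀ (h0 β) (h1 β)
  have hg0 : 0 ≤ ∑ β, w q β * Φ β ^ 2 :=
    Finset.sum_nonneg fun β _ => mul_nonneg (hwq β).le (sq_nonneg _)
  rw [hdiff] at hcs
  have hsub : ∑ β, w q β * Φ β - ∑ β, w p β * Φ β = ∑ β, (w q β - w p β) * Φ β := by
    rw [← Finset.sum_sub_distrib]
    exact Finset.sum_congr rfl fun β _ => by ring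
  rw [hsub]
  by_contra! hcon
  have : (1 + χ) ^ n - 1 ≤ 2 / 9 := by linarith
  nlinarith

variable {S Ξ : Type*} [MeasurableSpace S] [MeasurableSpace Ξ]

/-- The samples are the image of independent bits, and an integral over finitely many bit strings is
a weighted sum. This brings expectations into the form used by `sum_bernoulliWeight_sub_lt`. -/
lemma integral_prod_pi_twoPoint [MeasurableSingletonClass S] (ν : Measure Ξ)
    [IsProbabilityMeasure ν] {p : ℝ} (h0 : 0 ≤ p) (h1 : p ≤ 1) (a b : S) {n : ℕ}
    {f : Ξ × (Fin n → S) → ℝ} (hf : Measurable f) {C : ℝ} (hC : ∀ ω, |f ω| ≤ C) :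
    ∫ ω, f ω ∂(ν.prod (Measure.pi fun _ : Fin n => twoPoint p a b)) =
      ∑ β : Fin n → Bool, (∏ i, bernoulliWeight p (β i)) *
        ∫ ξ, f (ξ, fun i => cond (β i) a b) ∂ν := by
  have hprob := isProbabilityMeasure_twoPoint h0 h1 true false
  have hprob' := isProbabilityMeasure_twoPoint h0 h1 a b
  have hm : Measurable fun t : Bool => cond t a b := measurable_of_countable _
  have hmp : Measurable fun (β : Fin n → Bool) (i : Fin n) => cond (β i) a b :=
    measurable_of_countable _
  have e1 : twoPoint p a b = (twoPoint p true false).map fun t => cond t a b :=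
    (map_twoPoint hm p true false).symm
  have hsf : SigmaFinite ((twoPoint p true false).map fun t => cond t a b) := by
    rw [← e1]; infer_instance
  have e2 : (Measure.pi fun _ : Fin n => twoPoint p a b) =
      (Measure.pi fun _ : Fin n => twoPoint p true false).map
        fun (β : Fin n → Bool) (i : Fin n) => cond (β i) a b := by
    rw [Measure.pi_map_pi (hμ := fun _ => hsf) fun _ => hm.aemeasurable, e1]
  have e3 : ν.prod (Measure.pi fun _ : Fin n => twoPoint p a b) =
      (ν.prod (Measure.pi fun _ : Fin n => twoPoint p true false)).map
        (Prod.map id fun (β : Fin n → Bool) (i : Fin n) => cond (β i) a b) := by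
    rw [← Measure.map_prod_map _ _ measurable_id hmp, Measure.map_id, e2]
  have hmm : Measurable (Prod.map (id : Ξ → Ξ)
      fun (β : Fin n → Bool) (i : Fin n) => cond (β i) a b) := measurable_id.prodMap hmp
  rw [e3, integral_map hmm.aemeasurable hf.aestronglyMeasurable, integral_prod_symm]
  · rw [integral_fintype (Integrable.of_finite)]
    refine Finset.sum_congr rfl fun β _ => ?_
    rw [smul_eq_mul]
    congr 1
    rw [Measure.real, Measure.pi_singleton, ENNReal.toReal_prod]
    refine Finset.prod_congr rfl fun i _ => ?_
    cases h : β i <;> simp [twoPoint, bernoulliWeight, h0, h1]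
  · exact Integrable.of_bound (hf.comp hmm).aestronglyMeasurable C
      (Filter.Eventually.of_forall fun ω => hC _)

/-- If the loss is `κ₀ + κ φ(x)` on one atom and `κ₀ - κ φ(x)` on the other, then no estimator
based on few samples is good for the conditional value at risk of every two-point distribution. -/
lemma exists_twoPoint_cvar_gap [MeasurableSingletonClass S] {a b : S} (hab : a ≠ b)
    (ν : Measure Ξ) [IsProbabilityMeasure ν] {X : Type*} [MeasurableSpace X] {n : ℕ}
    {xhat : Ξ × (Fin n → S) → X} (hx : Measurable xhat) {l : X → S → ℝ} {φ : X → ℝ}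
    (hφ : Measurable φ) {R κ κ₀ α ε : ℝ} (hR : 0 < R) (hκ : 0 < κ) (hα : 0 < α) (hα1 : α ≤ 1)
    (hε : 0 < ε) (hεR : 32 * ε ≤ κ * R) (hφR : ∀ x, |φ x| ≤ R) {x0 xR : X} (hx0 : φ x0 = 0)
    (hxR : φ xR = R) (hla : ∀ x, l x a = κ₀ + κ * φ x) (hlb : ∀ x, l x b = κ₀ - κ * φ x)
    (hn : n * (α * (2 * ε / (κ * R)) ^ 2) ≤ 1 / 512) :
    ∃ P₀ : Measure S, IsProbabilityMeasure P₀ ∧ IsTwoPoint P₀ ∧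
      ExpectedGapGT (ν.prod (Measure.pi fun _ : Fin n => P₀)) (fun x => cvar α P₀ (l x)) xhat
        ε := by
  -- With this bias the full separation `2 δ κ R` equals `4 ε`; half of it, shared by two
  -- hypotheses, leaves `2 ε`.
  set δ := 2 * ε / (κ * R) with hδ
  have hδ0 : 0 < δ := by positivity
  have hδ1 : δ ≤ 1 / 16 := by rw [hδ, div_le_iff₀ (by positivity)]; linarith
  have hεδ : ε = δ * (κ * R) / 2 := by rw [hδ]; field_simp
  have h1α : 1 ≤ 1 / α := by rw [le_div_iff₀ hα]; linarith
  set v : ℝ → ℝ := fun u => max 0 (1 + u - 1 / α) with hv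
  have hF : ∀ u, 0 < u → u < 1 → ∀ x, cvar α (twoPoint (α * u) a b) (l x) =
      max (κ₀ + (2 * u - 1) * (κ * φ x)) (κ₀ + (2 * v u - 1) * (κ * φ x)) := by
    intro u hu0 hu1 x
    rw [cvar_twoPoint hα hα1 hu0 hu1 hab, hla, hlb]
    congr 1 <;> ring
  have hvu : ∀ u, 0 < u → v u ≤ u := fun u hu => max_le hu.le (by linarith)
  have hv0 : ∀ u, 0 ≤ v u := fun u => le_max_left _ _
  have hκφ : ∀ x, |κ * φ x| ≤ κ * R := fun x => by
    rw [abs_mul, abs_of_pos hκ]; exact mul_le_mul_of_nonneg_left (hφR x) hκ.le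
  have haff : ∀ u, 0 ≤ u → u ≤ 1 → ∀ x, |κ₀ + (2 * u - 1) * (κ * φ x)| ≤ |κ₀| + κ * R := by
    intro u hu0 hu1 x
    refine (abs_add_le _ _).trans ?_
    gcongr
    rw [abs_mul]
    exact (mul_le_of_le_one_left (abs_nonneg _) (by rw [abs_le]; constructor <;> linarith)).trans
      (hκφ x)
  have hbd : ∀ u, 0 < u → u < 1 → ∀ x,
      |cvar α (twoPoint (α * u) a b) (l x)| ≤ |κ₀| + κ * R := by
    intro u hu0 hu1 x
    rw [hF u hu0 hu1]
    exact abs_max_le_max_abs_abs.trans (max_le (haff u hu0.le hu1.le x)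
      (haff _ (hv0 u) ((hvu u hu0).trans hu1.le) x))
  have hmeas : ∀ u, 0 < u → u < 1 → Measurable fun x => cvar α (twoPoint (α * u) a b) (l x) := by
    intro u hu0 hu1
    simp only [hF u hu0 hu1]
    fun_prop
  have hαu : ∀ u, 0 < u → u < 1 → 0 < α * u ∧ α * u < 1 := fun u h0 h1 =>
    ⟨by positivity, by nlinarith⟩
  have hint : ∀ u, 0 < u → u < 1 → Integrable
      (fun ω => cvar α (twoPoint (α * u) a b) (l (xhat ω)))
      (ν.prod (Measure.pi fun _ : Fin n => twoPoint (α * u) a b)) := by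
    intro u hu0 hu1
    have := isProbabilityMeasure_twoPoint (hαu u hu0 hu1).1.le (hαu u hu0 hu1).2.le a b
    exact Integrable.of_bound ((hmeas u hu0 hu1).comp hx).aestronglyMeasurable _
      (Filter.Eventually.of_forall fun ω => hbd u hu0 hu1 _)
  have hinf : ∀ u, 0 < u → u < 1 → ∀ x, ⨅ x', cvar α (twoPoint (α * u) a b) (l x') ≤
      cvar α (twoPoint (α * u) a b) (l x) := fun u hu0 hu1 x =>
    ciInf_le ⟨-(|κ₀| + κ * R), by rintro _ ⟨y, rfl⟩; exact (abs_le.1 (hbd u hu0 hu1 y)).1⟩ x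
  -- A soft test in `[0, 1]`: the excess is at least `4 ε ψ` under bias `+δ` and at least `4 ε (1 -
  -- ψ)` under bias `-δ`.
  set ψ : X → ℝ := fun x => max 0 (φ x) / R with hψ
  have hψm : Measurable ψ := by fun_prop
  have hψ0 : ∀ x, 0 ≤ ψ x := fun x => by positivity
  have hψ1 : ∀ x, ψ x ≤ 1 := fun x => by
    rw [hψ, div_le_one hR]; exact max_le hR.le ((le_abs_self _).trans (hφR x))
  have hψabs : ∀ ω, |ψ (xhat ω)| ≤ 1 := fun ω => by
    rw [abs_of_nonneg (hψ0 _)]; exact hψ1 _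
  have hψR : ∀ x, R * ψ x = max 0 (φ x) := fun x => by rw [hψ]; field_simp
  have hup0 : 0 < 1 / 2 + δ := by positivity
  have hup1 : 1 / 2 + δ < 1 := by linarith
  have hum0 : 0 < 1 / 2 - δ := by linarith
  have hum1 : 1 / 2 - δ < 1 := by linarith
  have hgp : ∀ x, (⨅ x', cvar α (twoPoint (α * (1 / 2 + δ)) a b) (l x')) + 2 * δ * κ * R * ψ x ≤
      cvar α (twoPoint (α * (1 / 2 + δ)) a b) (l x) := by
    intro x
    have h1 := hinf _ hup0 hup1 x
    have h2 := hinf _ hup0 hup1 x0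
    rw [hF _ hup0 hup1 x0, hx0] at h2
    simp only [mul_zero, add_zero, max_self] at h2
    rw [mul_assoc (2 * δ * κ), hψR]
    rcases le_total (φ x) 0 with h | h
    · rw [max_eq_left h]; linarith
    · rw [max_eq_right h, hF _ hup0 hup1 x]
      refine le_max_of_le_left ?_
      linarith
  -- At `xR` the branch with `u` is the larger one because `v u ≤ u`, so the infimum is at most `κ₀
  -- - 2 δ κ R`.
  have hgm : ∀ x, (⨅ x', cvar α (twoPoint (α * (1 / 2 - δ)) a b) (l x'))
      + 2 * δ * κ * R * (1 - ψ x) ≤ cvar α (twoPoint (α * (1 / 2 - δ)) a b) (l x) := by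
    intro x
    have h2 := hinf _ hum0 hum1 xR
    rw [hF _ hum0 hum1 xR, hxR, max_eq_left] at h2
    · have h3 : 2 * δ * κ * R * (1 - ψ x) = 2 * δ * κ * (R - max 0 (φ x)) := by
        rw [← hψR]; ring
      rw [h3, hF _ hum0 hum1 x]
      refine le_max_of_le_left ?_
      have : δ * κ * φ x ≤ δ * κ * max 0 (φ x) := by gcongr; exact le_max_right _ _
      linarith
    · have := hvu _ hum0
      gcongr
  have hP : ∀ u, 0 < u → u < 1 → ∫ ω, ψ (xhat ω)
      ∂(ν.prod (Measure.pi fun _ : Fin n => twoPoint (α * u) a b)) = _ := fun u h0 h1 =>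
    integral_prod_pi_twoPoint ν (hαu u h0 h1).1.le (hαu u h0 h1).2.le a b (hψm.comp hx) hψabs
  have hprob : ∀ u, 0 < u → u < 1 → IsProbabilityMeasure
      (ν.prod (Measure.pi fun _ : Fin n => twoPoint (α * u) a b)) := by
    intro u h0 h1
    have := isProbabilityMeasure_twoPoint (hαu u h0 h1).1.le (hαu u h0 h1).2.le a b
    infer_instance
  have hψi : ∀ u, 0 < u → u < 1 → Integrable (fun ω => ψ (xhat ω))
      (ν.prod (Measure.pi fun _ : Fin n => twoPoint (α * u) a b)) := by
    intro u h0 h1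
    have := hprob u h0 h1
    exact Integrable.of_bound (hψm.comp hx).aestronglyMeasurable 1
      (Filter.Eventually.of_forall hψabs)
  set μ : ℝ → Measure (Ξ × (Fin n → S)) := fun u =>
    ν.prod (Measure.pi fun _ : Fin n => twoPoint (α * u) a b) with hμ
  have hIp : (⨅ x', cvar α (twoPoint (α * (1 / 2 + δ)) a b) (l x'))
      + 2 * δ * κ * R * ∫ ω, ψ (xhat ω) ∂(μ (1 / 2 + δ)) ≤
      ∫ ω, cvar α (twoPoint (α * (1 / 2 + δ)) a b) (l (xhat ω)) ∂(μ (1 / 2 + δ)) := by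
    have := hprob _ hup0 hup1
    have h := integral_mono ((integrable_const _).add ((hψi _ hup0 hup1).const_mul
      (2 * δ * κ * R))) (hint _ hup0 hup1) fun ω => hgp (xhat ω)
    simp only [Pi.add_apply] at h
    rwa [integral_add (integrable_const _) ((hψi _ hup0 hup1).const_mul _), integral_const,
      integral_const_mul, probReal_univ, one_smul] at h
  have hIm : (⨅ x', cvar α (twoPoint (α * (1 / 2 - δ)) a b) (l x'))
      + 2 * δ * κ * R * (1 - ∫ ω, ψ (xhat ω) ∂(μ (1 / 2 - δ))) ≤
      ∫ ω, cvar α (twoPoint (α * (1 / 2 - δ)) a b) (l (xhat ω)) ∂(μ (1 / 2 - δ)) := by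
    have := hprob _ hum0 hum1
    have hi : Integrable (fun ω => 1 - ψ (xhat ω)) (μ (1 / 2 - δ)) :=
      (integrable_const _).sub (hψi _ hum0 hum1)
    have h := integral_mono ((integrable_const _).add (hi.const_mul
      (2 * δ * κ * R))) (hint _ hum0 hum1) fun ω => hgm (xhat ω)
    simp only [Pi.add_apply] at h
    rwa [integral_add (integrable_const _) (hi.const_mul _), integral_const,
      integral_const_mul, integral_sub (integrable_const _) (hψi _ hum0 hum1), integral_const,
      probReal_univ, one_smul, one_smul] at h
  have hpq := sum_bernoulliWeight_sub_lt (hαu _ hup0 hup1).1 (hαu _ hup0 hup1).2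
    (hαu _ hum0 hum1).1 (hαu _ hum0 hum1).2 (n := n) ?_
    (fun β => integral_nonneg fun ξ => hψ0 (xhat (ξ, fun i => cond (β i) a b)))
    (fun β => (integral_mono_of_nonneg (μ := ν)
      (Filter.Eventually.of_forall fun ξ => hψ0 (xhat (ξ, fun i => cond (β i) a b)))
      (integrable_const 1) (Filter.Eventually.of_forall fun ξ => hψ1 _)).trans (by simp))
  · rw [← hP _ hup0 hup1, ← hP _ hum0 hum1] at hpq
    -- The expectations of `ψ` differ by less than `1/2`, so the two expected excesses add up to
    -- more than `2 ε`.
    have hmain : ε < ∫ ω, cvar α (twoPoint (α * (1 / 2 + δ)) a b) (l (xhat ω)) ∂(μ (1 / 2 + δ))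
        - (⨅ x', cvar α (twoPoint (α * (1 / 2 + δ)) a b) (l x')) ∨
        ε < ∫ ω, cvar α (twoPoint (α * (1 / 2 - δ)) a b) (l (xhat ω)) ∂(μ (1 / 2 - δ))
        - (⨅ x', cvar α (twoPoint (α * (1 / 2 - δ)) a b) (l x')) := by
      by_contra! hcon
      have h0 : 0 < δ * (κ * R) := by positivity
      have : 2 * δ * κ * R * (1 - (∫ ω, ψ (xhat ω) ∂(μ (1 / 2 - δ))
          - ∫ ω, ψ (xhat ω) ∂(μ (1 / 2 + δ)))) > 2 * δ * κ * R * (1 / 2) :=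
        mul_lt_mul_of_pos_left (by linarith) (by positivity)
      nlinarith [hcon.1, hcon.2]
    rcases hmain with h | h
    · exact ⟨_, isProbabilityMeasure_twoPoint (hαu _ hup0 hup1).1.le (hαu _ hup0 hup1).2.le a b,
        isTwoPoint_twoPoint (hαu _ hup0 hup1).1.le (hαu _ hup0 hup1).2.le a b,
        hint _ hup0 hup1, h⟩
    · exact ⟨_, isProbabilityMeasure_twoPoint (hαu _ hum0 hum1).1.le (hαu _ hum0 hum1).2.le a b,
        isTwoPoint_twoPoint (hαu _ hum0 hum1).1.le (hαu _ hum0 hum1).2.le a b,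
        hint _ hum0 hum1, h⟩
  -- The numerator is `4 α² δ²` and the denominator at least `7 α / 32`. Only one factor `α`
  -- cancels, whence the `1/α` in the sample bound.
  · have h1 : (α * (1 / 2 + δ) - α * (1 / 2 - δ)) ^ 2 /
        (α * (1 / 2 - δ) * (1 - α * (1 / 2 - δ))) ≤ 128 / 7 * (α * δ ^ 2) := by
      have hq : α * (1 / 2 - δ) ≤ 1 / 2 := by nlinarith
      rw [div_le_iff₀ (mul_pos (by positivity) (by linarith))]
      have h2 : (7 / 32 : ℝ) ≤ (1 / 2 - δ) * (1 - α * (1 / 2 - δ)) := by nlinarith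
      have h3 : 0 ≤ α ^ 2 * δ ^ 2 := by positivity
      nlinarith
    calc (n : ℝ) * _ ≤ n * (128 / 7 * (α * δ ^ 2)) := by gcongr
      _ = 128 / 7 * (n * (α * δ ^ 2)) := by ring
      _ ≤ 1 / 9 := by linarith

end Testing

/-! ### Measurability and counting of oracle transcripts. -/

section Transcripts

variable {Ξ X Y S : Type*} [MeasurableSpace Ξ] [MeasurableSpace X] [MeasurableSpace Y]

lemma Algorithm.measurable_answers [MeasurableSpace S] (A : Algorithm Ξ X Y) {O : X → S → Y}
    (hO : Measurable fun p : X × S => O p.1 p.2) (t : ℕ) :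
    Measurable fun ω : Ξ × (Fin t → S) => A.answers O ω.1 t ω.2 := by
  induction t with
  | zero => exact measurable_pi_iff.2 fun i => i.elim0
  | succ t ih =>
    have hinit : Measurable fun ω : Ξ × (Fin (t + 1) → S) =>
        (ω.1, fun i : Fin t => ω.2 i.castSucc) := by fun_prop
    have hans := ih.comp hinit
    refine measurable_pi_iff.2 fun i => ?_
    refine Fin.lastCases ?_ (fun j => ?_) i
    · simp only [Algorithm.answers, Fin.snoc_last]
      have hpt := (A.measurable_point t).comp (measurable_fst.prodMk hans)
      exact hO.comp (hpt.prodMk ((measurable_pi_apply (Fin.last t)).comp measurable_snd))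
    · simp only [Algorithm.answers, Fin.snoc_castSucc]
      exact (measurable_pi_apply j).comp hans

/-- This turns an oracle algorithm into a measurable estimator based on the seed and the samples, to
which the testing bound applies. -/
lemma Algorithm.measurable_output [MeasurableSpace S] (A : Algorithm Ξ X Y) {O : X → S → Y}
    (hO : Measurable fun p : X × S => O p.1 p.2) (T : ℕ) :
    Measurable (A.output O T : Ξ × (Fin T → S) → X) :=
  (A.measurable_point T).comp (measurable_fst.prodMk (A.measurable_answers hO T))

/-- If, over a family of oracles, the answer to a query in a round with sample `s` takes at most
`B s` values, then the number of possible transcripts is at most the product of the `B s`. -/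
lemma Algorithm.exists_finset_answers {Θ : Type*} (A : Algorithm Ξ X Y) (O : Θ → X → S → Y)
    (B : S → ℕ) (hB : ∀ x s, ∃ F : Finset Y, F.card ≤ B s ∧ ∀ θ, O θ x s ∈ F) (ξ : Ξ) (t : ℕ)
    (s : Fin t → S) :
    ∃ F : Finset (Fin t → Y), F.card ≤ ∏ i, B (s i) ∧ ∀ θ, A.answers (O θ) ξ t s ∈ F := by
  classical
  induction t with
  | zero => exact ⟨{fun i => i.elim0}, by simp, fun θ => by simp [Algorithm.answers]⟩
  | succ t ih =>
    obtain ⟨F, hF, hmem⟩ := ih fun i => s i.castSucc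
    -- The next query is determined by the seed and the earlier answers, whatever `θ`, so each
    -- transcript branches into at most `B` continuations.
    choose E hE hEmem using fun x => hB x (s (Fin.last t))
    refine ⟨F.biUnion fun h => (E (A.point t ξ h)).image fun y =>
      Fin.snoc (α := fun _ => Y) h y, ?_, fun θ => ?_⟩
    · rw [Fin.prod_univ_castSucc]
      refine (Finset.card_biUnion_le_card_mul _ _ (B (s (Fin.last t))) fun h _ =>
        Finset.card_image_le.trans (hE _)).trans ?_
      gcongr
    · simp only [Finset.mem_biUnion, Finset.mem_image]
      exact ⟨_, hmem θ, _, hEmem _ θ, rfl⟩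

end Transcripts

/-! ### The two CVaR lower bounds, from bilinear losses. -/

section OneDimensional

lemma cvar_lower_bound_oracle {G R α ε : ℝ} (hG : 0 < G) (hR : 0 < R) (hα : 0 < α) (hα1 : α ≤ 1)
    (hε : 0 < ε) (hεR : ε < G * R / 64) {d : ℕ} (hd : 1 ≤ d) :
    ∃ ℓ : Eucl d → Sample → ℝ, IsLoss G R ℓ ∧ (∃ g, IsSubgradient R ℓ g) ∧
      ∀ g : Eucl d → Sample → Eucl d, IsSubgradient R ℓ g →
      ∀ T : ℕ, (T : ℝ) ≤ 2⁻¹ ^ 20 * ((G * R) ^ 2 / (α * ε ^ 2)) →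
      ∀ (Ξ : Type u) [MeasurableSpace Ξ] (ν : Measure Ξ) [IsProbabilityMeasure ν]
        (A : Algorithm Ξ (Dom d R) (ℝ × Eucl d)),
      ∃ P₀ : Measure Sample, IsProbabilityMeasure P₀ ∧ IsTwoPoint P₀ ∧
        ExpectedGapGT (ν.prod (Measure.pi fun _ : Fin T => P₀))
          (fun x : Dom d R => cvar α P₀ (ℓ x)) (A.output (firstOrderOracle ℓ g) T) ε := by
  let i0 : Fin d := ⟨0, hd⟩
  -- The loss uses one coordinate only, so the dimension is irrelevant; the shift and the factor `G
  -- / 2` keep its values in `[0, G R]`.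
  let ℓ : Eucl d → Sample → ℝ := fun x s => G / 2 * R + G / 2 * ((s : ℝ) * x i0)
  have habs : ∀ (s : Sample) (x : Eucl d), |(s : ℝ) * x i0| ≤ ‖x‖ := fun s x => by
    rw [abs_mul]
    calc |(s : ℝ)| * |x i0| ≤ 1 * ‖x‖ := by
          gcongr
          · exact abs_le.2 s.2
          · exact PiLp.norm_apply_le x i0
      _ = ‖x‖ := one_mul _
  have hdiff : ∀ (s : Sample) (x y : Eucl d), ℓ x s - ℓ y s = G / 2 * ((s : ℝ) * (x - y) i0) := by
    intro s x y
    simp only [ℓ, PiLp.sub_apply]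
    ring
  have hℓ : IsLoss G R ℓ := by
    refine ⟨by fun_prop, fun s => ⟨convex_closedBall _ _, fun x _ y _ a b _ _ hab => ?_⟩,
      fun s x _ y _ => ?_, fun s x hx => ?_⟩
    · simp only [ℓ, PiLp.add_apply, PiLp.smul_apply, smul_eq_mul]
      apply le_of_eq
      linear_combination (-(G / 2 * R)) * hab
    · rw [hdiff, abs_mul, abs_of_pos (half_pos hG)]
      have := habs s (x - y)
      have := norm_nonneg (x - y)
      nlinarith
    · have hx' : ‖x‖ ≤ R := by simpa using hx
      have := abs_le.1 ((habs s x).trans hx')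
      simp only [ℓ]
      constructor <;> nlinarith [this.1, this.2]
  refine ⟨ℓ, hℓ, ⟨fun _ s => (G / 2 * (s : ℝ)) • EuclideanSpace.single i0 1, by fun_prop, ?_⟩, ?_⟩
  · intro s x _ y _
    have := hdiff s y x
    rw [inner_smul_left, EuclideanSpace.inner_single_left]
    simp only [map_one, one_mul, conj_trivial]
    linarith
  · intro g hg T hT Ξ _ ν _ A
    have hO : Measurable fun p : Dom d R × Sample => firstOrderOracle (R := R) ℓ g p.1 p.2 :=
      hℓ.measurable.prodMk hg.measurable
    have hab : (⟨1, by simp⟩ : Sample) ≠ ⟨-1, by simp⟩ := by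
      intro h
      have := congrArg Subtype.val h
      norm_num at this
    refine exists_twoPoint_cvar_gap hab ν (A.measurable_output hO T) (φ := fun x => (x : Eucl d) i0)
      (R := R) (κ := G / 2) (κ₀ := G / 2 * R) (by fun_prop) hR (half_pos hG) hα hα1 hε
      (by linarith) (fun x => ?_) (x0 := ⟨0, by simp [hR.le]⟩)
      (xR := ⟨EuclideanSpace.single i0 R, by simp [abs_of_pos hR]⟩) (by simp) (by simp)
      (fun x => by simp [ℓ]) (fun x => by simp [ℓ]; ring) ?_
    · have hx' : ‖(x : Eucl d)‖ ≤ R := mem_closedBall_zero_iff.1 x.2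
      exact (PiLp.norm_apply_le (x : Eucl d) i0).trans hx'
    · calc T * (α * (2 * ε / (G / 2 * R)) ^ 2)
          ≤ 2⁻¹ ^ 20 * ((G * R) ^ 2 / (α * ε ^ 2)) * (α * (2 * ε / (G / 2 * R)) ^ 2) := by gcongr
        _ = 2⁻¹ ^ 20 * 16 := by field_simp; norm_num
        _ ≤ 1 / 512 := by norm_num

lemma cvar_lower_bound_samples {G R α ε : ℝ} (hG : 0 < G) (hR : 0 < R) (hα : 0 < α)
    (hα1 : α ≤ 1) (hε : 0 < ε) (hεR : ε < G * R / 64) {n : ℕ}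
    (hn : (n : ℝ) ≤ (G * R) ^ 2 / (2048 * α * ε ^ 2)) {Ξ : Type u} [MeasurableSpace Ξ]
    (ν : Measure Ξ) [IsProbabilityMeasure ν]
    {xhat : Ξ × (Fin n → Icc (-G) G) → Icc (-R) R} (hx : Measurable xhat) :
    ∃ P₀ : Measure (Icc (-G) G), IsProbabilityMeasure P₀ ∧ IsTwoPoint P₀ ∧
      ExpectedGapGT (ν.prod (Measure.pi fun _ : Fin n => P₀))
        (fun x : Icc (-R) R => cvar α P₀ fun s => (x : ℝ) * (s : ℝ)) xhat ε := by
  have hab : (⟨G, by constructor <;> linarith⟩ : Icc (-G) G) ≠ ⟨-G, by constructor <;> linarith⟩ := by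
    intro h
    have := congrArg Subtype.val h
    simp only at this
    linarith
  refine exists_twoPoint_cvar_gap hab ν hx (φ := fun x => (x : ℝ)) (R := R) (κ := G) (κ₀ := 0)
    measurable_subtype_coe hR hG hα hα1 hε (by linarith) (fun x => abs_le.2 x.2)
    (x0 := ⟨0, by constructor <;> linarith⟩) (xR := ⟨R, by constructor <;> linarith⟩) rfl rfl
    (fun x => by ring) (fun x => by ring) ?_
  calc n * (α * (2 * ε / (G * R)) ^ 2)
      ≤ (G * R) ^ 2 / (2048 * α * ε ^ 2) * (α * (2 * ε / (G * R)) ^ 2) := by gcongr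
    _ = 1 / 512 := by field_simp; norm_num
    _ ≤ 1 / 512 := le_rfl

end OneDimensional

/-! ### Maxima of linear forms, active at a single sample. -/

section MaxLoss

/-- Breaking ties by a measurable selector makes the subgradient of the maximum measurable, and lets
an answer depend only on the selected form. -/
lemma exists_measurable_argmax {E : Type*} [MeasurableSpace E] {N : ℕ} (hN : 0 < N)
    {h : Fin N → E → ℝ} (hh : ∀ i, Measurable (h i)) :
    ∃ k : E → Fin N, Measurable k ∧ ∀ x i, h i x ≤ h (k x) x := by
  suffices H : ∀ s : Finset (Fin N), ∃ k : E → Fin N, Measurable k ∧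
      ∀ x, ∀ i ∈ s, h i x ≤ h (k x) x by
    obtain ⟨k, hk, hmax⟩ := H Finset.univ
    exact ⟨k, hk, fun x i => hmax x i (Finset.mem_univ i)⟩
  intro s
  induction s using Finset.induction_on with
  | empty => exact ⟨fun _ => ⟨0, hN⟩, measurable_const, by simp⟩
  | insert a s _ ih =>
    obtain ⟨k, hk, hmax⟩ := ih
    have hm : Measurable fun x => h (k x) x :=
      (measurable_from_prod_countable_right (f := fun p : Fin N × E => h p.1 p.2) hh).comp
        (hk.prodMk measurable_id)
    classical
    refine ⟨fun x => if h (k x) x ≤ h a x then a else k x,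
      Measurable.ite (measurableSet_le hm (hh a)) measurable_const hk, fun x i hi => ?_⟩
    beta_reduce
    rcases Finset.mem_insert.1 hi with rfl | hi
    · split_ifs with hc
      · exact le_rfl
      · exact (not_le.1 hc).le
    · split_ifs with hc
      · exact (hmax x i hi).trans hc
      · exact hmax x i hi

variable {d N : ℕ}

/-- The loss that is a shifted maximum of linear functions on the sample `1` and vanishes on the
other samples; `k` selects the maximal linear function. -/
def maxLoss (G R : ℝ) (w : Fin N → Eucl d) (k : Eucl d → Fin N) (x : Eucl d) (s : Sample) : ℝ :=
  if (s : ℝ) = 1 then G * R / 2 + G / 4 * inner ℝ (w (k x)) x else 0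

/-- The subgradient of `maxLoss`. -/
def maxLossGrad (G : ℝ) (w : Fin N → Eucl d) (k : Eucl d → Fin N) (x : Eucl d) (s : Sample) :
    Eucl d :=
  if (s : ℝ) = 1 then (G / 4) • w (k x) else 0

lemma measurableSet_snd_eq_one {E : Type*} [MeasurableSpace E] :
    MeasurableSet {p : E × Sample | (p.2 : ℝ) = 1} :=
  measurableSet_eq_fun (by fun_prop) measurable_const

/-- A maximum of forms of norm at most one is convex and `1`-Lipschitz. The offset `G R / 2` and
slope `G / 4` leave the active loss at least `G R / 4`, as needed for the point mass to be optimal.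
-/
lemma isLoss_maxLoss {G R : ℝ} (hG : 0 < G) {w : Fin N → Eucl d} (hw : ∀ i, ‖w i‖ ≤ 1)
    {k : Eucl d → Fin N} (hk : Measurable k)
    (hmax : ∀ x i, inner ℝ (w i) x ≤ inner ℝ (w (k x)) x) : IsLoss G R (maxLoss G R w k) := by
  have hin : ∀ i x, |inner ℝ (w i) x| ≤ ‖x‖ := fun i x =>
    (abs_real_inner_le_norm _ _).trans (mul_le_of_le_one_left (norm_nonneg _) (hw i))
  have hlip : ∀ x y, inner ℝ (w (k x)) x - inner ℝ (w (k y)) y ≤ ‖x - y‖ := fun x y => by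
    have h1 := hmax y (k x)
    have h2 := (abs_le.1 (hin (k x) (x - y))).2
    rw [inner_sub_right] at h2
    linarith
  refine ⟨?_, fun s => ⟨convex_closedBall _ _, fun x _ y _ a b ha hb hab => ?_⟩,
    fun s x _ y _ => ?_, fun s x hx => ?_⟩
  · have hm : Measurable fun x => inner ℝ (w (k x)) x :=
      ((measurable_of_countable w).comp hk).inner measurable_id
    exact Measurable.ite measurableSet_snd_eq_one
      (((hm.comp (measurable_subtype_coe.comp measurable_fst)).const_mul _).const_add _)
      measurable_const
  · unfold maxLoss
    split_ifs with hs
    · have h1 := hmax x (k (a • x + b • y))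
      have h2 := hmax y (k (a • x + b • y))
      set v := w (k (a • x + b • y))
      simp only [inner_add_right, inner_smul_right, smul_eq_mul]
      have h3 : a * inner ℝ v x ≤ a * inner ℝ (w (k x)) x := by gcongr
      have h4 : b * inner ℝ v y ≤ b * inner ℝ (w (k y)) y := by gcongr
      have h5 : G / 4 * (a * inner ℝ v x + b * inner ℝ v y) ≤
          G / 4 * (a * inner ℝ (w (k x)) x + b * inner ℝ (w (k y)) y) := by gcongr
      linear_combination h5 - G * R / 2 * hab
    · simp
  · unfold maxLoss
    split_ifs with hs
    · have h1 := hlip x y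
      have h2 := hlip y x
      rw [norm_sub_rev] at h2
      rw [add_sub_add_left_eq_sub, ← mul_sub, abs_mul, abs_of_pos (by positivity)]
      have h3 : |inner ℝ (w (k x)) x - inner ℝ (w (k y)) y| ≤ ‖x - y‖ :=
        abs_le.2 ⟨by linarith, h1⟩
      have h4 := norm_nonneg (x - y)
      nlinarith
    · simp only [sub_self, abs_zero]
      positivity
  · have hx' : ‖x‖ ≤ R := mem_closedBall_zero_iff.1 hx
    have hR : 0 ≤ R := (norm_nonneg x).trans hx'
    have h1 := abs_le.1 ((hin (k x) x).trans hx')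
    unfold maxLoss
    split_ifs with hs
    · constructor <;> nlinarith [h1.1, h1.2]
    · exact ⟨le_rfl, by positivity⟩

lemma isSubgradient_maxLossGrad {G R : ℝ} (hG : 0 < G) {w : Fin N → Eucl d}
    {k : Eucl d → Fin N} (hk : Measurable k)
    (hmax : ∀ x i, inner ℝ (w i) x ≤ inner ℝ (w (k x)) x) :
    IsSubgradient R (maxLoss G R w k) (maxLossGrad G w k) := by
  refine ⟨?_, fun s x _ y _ => ?_⟩
  · have hm : Measurable fun x => w (k x) := (measurable_of_countable w).comp hk
    exact Measurable.ite measurableSet_snd_eq_one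
      ((hm.comp (measurable_subtype_coe.comp measurable_fst)).const_smul (G / 4)) measurable_const
  · unfold maxLoss maxLossGrad
    split_ifs with hs
    · rw [real_inner_smul_left, inner_sub_right]
      have h : G / 4 * inner ℝ (w (k x)) y ≤ G / 4 * inner ℝ (w (k y)) y := by
        gcongr
        exact hmax y (k x)
      linarith
    · simp

lemma norm_maxLossGrad_le {G : ℝ} (hG : 0 < G) {w : Fin N → Eucl d} (hw : ∀ i, ‖w i‖ ≤ 1)
    (k : Eucl d → Fin N) (x : Eucl d) (s : Sample) : ‖maxLossGrad G w k x s‖ ≤ G := by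
  unfold maxLossGrad
  split_ifs
  · rw [norm_smul, Real.norm_eq_abs, abs_of_pos (by positivity)]
    nlinarith [hw (k x)]
  · simpa using hG.le

end MaxLoss

/-! ### Random sign vectors on disjoint blocks. -/

section SignVectors

/-- The sign `±1` encoded by a Boolean. -/
def boolSign (t : Bool) : ℝ := cond t 1 (-1)

lemma boolSign_mul_self (t : Bool) : boolSign t * boolSign t = 1 := by
  cases t <;> simp [boolSign]

variable {N m : ℕ}

/-- The unit vector supported on the block `i` of coordinates, with signs `τ`. -/
def signVec (i : Fin N) (τ : Fin m → Bool) : Eucl (N * m) :=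
  WithLp.toLp 2 fun c => if (finProdFinEquiv.symm c).1 = i
    then boolSign (τ (finProdFinEquiv.symm c).2) / √m else 0

lemma signVec_apply (i i' : Fin N) (τ : Fin m → Bool) (j : Fin m) :
    signVec i τ (finProdFinEquiv (i', j)) = if i' = i then boolSign (τ j) / √m else 0 := by
  simp only [signVec, Equiv.symm_apply_apply]

lemma inner_signVec (i : Fin N) (τ : Fin m → Bool) (x : Eucl (N * m)) :
    inner ℝ (signVec i τ) x = (∑ j, boolSign (τ j) * x (finProdFinEquiv (i, j))) / √m := by
  rw [PiLp.inner_apply, ← finProdFinEquiv.sum_comp, Fintype.sum_prod_type,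
    Finset.sum_eq_single i, Finset.sum_div]
  · refine Finset.sum_congr rfl fun j _ => ?_
    simp [signVec_apply]
    ring
  · intro i' _ hi'
    refine Finset.sum_eq_zero fun j _ => ?_
    simp [signVec_apply, hi']
  · simp

lemma norm_signVec_le (hm : 0 < m) (i : Fin N) (τ : Fin m → Bool) : ‖signVec i τ‖ ≤ 1 := by
  have hm' : (0 : ℝ) < m := by exact_mod_cast hm
  have h : inner ℝ (signVec i τ) (signVec i τ) = (1 : ℝ) := by
    rw [inner_signVec]
    have : ∀ j, boolSign (τ j) * signVec i τ (finProdFinEquiv (i, j)) = 1 / √m := fun j => by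
      rw [signVec_apply, if_pos rfl, ← mul_div_assoc, boolSign_mul_self]
    simp only [this]
    rw [Finset.sum_const, Finset.card_univ, Fintype.card_fin, nsmul_eq_mul, mul_one_div, div_div,
      Real.mul_self_sqrt hm'.le, div_self hm'.ne']
  rw [real_inner_self_eq_norm_sq] at h
  nlinarith [norm_nonneg (signVec i τ)]

/-- The sum factorizes over coordinates into `2 cosh`, and `cosh t ≤ exp(t²/2)`: the sub-Gaussian
bound for independent signs. -/
lemma sum_exp_sign_le (c : Fin N → Fin m → ℝ) :
    ∑ σ : Fin N → Fin m → Bool, Real.exp (∑ i, ∑ j, boolSign (σ i j) * c i j) ≤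
      2 ^ (N * m) * Real.exp ((∑ i, ∑ j, c i j ^ 2) / 2) := by
  have h1 : ∑ σ : Fin N → Fin m → Bool, Real.exp (∑ i, ∑ j, boolSign (σ i j) * c i j) =
      ∏ i, ∏ j, (2 * Real.cosh (c i j)) := by
    have : ∀ i j, 2 * Real.cosh (c i j) = ∑ t, Real.exp (boolSign t * c i j) := fun i j => by
      rw [Real.cosh_eq, Fintype.sum_bool]
      simp [boolSign]
      ring
    simp only [this, Fintype.prod_sum, Real.exp_sum]
  rw [h1]
  calc ∏ i, ∏ j, (2 * Real.cosh (c i j)) ≤ ∏ i, ∏ j, (2 * Real.exp (c i j ^ 2 / 2)) := by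
        refine Finset.prod_le_prod (fun i _ => Finset.prod_nonneg fun j _ => ?_) fun i _ =>
          Finset.prod_le_prod (fun j _ => ?_) fun j _ => ?_
        · have := Real.cosh_pos (c i j); positivity
        · have := Real.cosh_pos (c i j); positivity
        · gcongr; exact Real.cosh_le_exp_half_sq _
    _ = _ := by
        simp only [Finset.prod_mul_distrib, Finset.prod_const, Finset.card_univ, Fintype.card_fin,
          ← Real.exp_sum, ← Finset.sum_div]
        rw [← pow_mul, mul_comm m N]

/-- Few sign patterns have all block vectors negatively correlated with a given point. -/
lemma card_filter_inner_signVec_lt (hN : 0 < N) (hm : 0 < m) {R : ℝ} (hR : 0 < R)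
    {x : Eucl (N * m)} (hx : ‖x‖ ≤ R) :
    ((Finset.univ.filter fun σ : Fin N → Fin m → Bool =>
      ∀ i, inner ℝ (signVec i (σ i)) x < -(R / (2 * √N))).card : ℝ) ≤
      2 ^ (N * m) * Real.exp (-(N * m / 8)) := by
  have hN' : (0 : ℝ) < N := by exact_mod_cast hN
  have hm' : (0 : ℝ) < m := by exact_mod_cast hm
  have hsN : 0 < √(N : ℝ) := Real.sqrt_pos.2 hN'
  have hsm : 0 < √(m : ℝ) := Real.sqrt_pos.2 hm'
  have hN2 : √(N : ℝ) * √(N : ℝ) = N := Real.mul_self_sqrt hN'.le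
  have hm2 : √(m : ℝ) * √(m : ℝ) = m := Real.mul_self_sqrt hm'.le
  set A := Finset.univ.filter fun σ : Fin N → Fin m → Bool =>
      ∀ i, inner ℝ (signVec i (σ i)) x < -(R / (2 * √N))
  -- The optimal Chernoff parameter: the event forces exponent at least `Nm/4`, against a moment
  -- bound with exponent `Nm/8`.
  set θ : ℝ := √N * √m / (2 * R) with hθ
  have hsq : ∑ i, ∑ j, (-θ * x (finProdFinEquiv (i, j))) ^ 2 = θ ^ 2 * ‖x‖ ^ 2 := by
    rw [EuclideanSpace.norm_sq_eq, ← finProdFinEquiv.sum_comp, Fintype.sum_prod_type,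
      Finset.mul_sum]
    refine Finset.sum_congr rfl fun i _ => ?_
    rw [Finset.mul_sum]
    refine Finset.sum_congr rfl fun j _ => ?_
    rw [Real.norm_eq_abs, sq_abs]
    ring
  have hup := sum_exp_sign_le fun i j => -θ * x (finProdFinEquiv (i, j))
  rw [hsq] at hup
  have hθx : θ ^ 2 * ‖x‖ ^ 2 / 2 ≤ N * m / 8 := by
    have : θ ^ 2 * ‖x‖ ^ 2 ≤ θ ^ 2 * R ^ 2 := by gcongr
    have h2 : θ ^ 2 * R ^ 2 = N * m / 4 := by
      rw [hθ, div_pow, mul_pow, pow_two √(N : ℝ), pow_two √(m : ℝ), hN2, hm2]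
      field_simp
      norm_num
    linarith
  have hlow : ∀ σ ∈ A, Real.exp (N * m / 4) ≤
      Real.exp (∑ i, ∑ j, boolSign (σ i j) * (-θ * x (finProdFinEquiv (i, j)))) := by
    intro σ hσ
    have hσ' := (Finset.mem_filter.1 hσ).2
    apply Real.exp_le_exp.2
    have hi : ∀ i, (m : ℝ) / 4 ≤ ∑ j, boolSign (σ i j) * (-θ * x (finProdFinEquiv (i, j))) := by
      intro i
      have h := hσ' i
      rw [inner_signVec, div_lt_iff₀ hsm] at h
      have e : ∑ j, boolSign (σ i j) * (-θ * x (finProdFinEquiv (i, j))) =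
          θ * -∑ j, boolSign (σ i j) * x (finProdFinEquiv (i, j)) := by
        rw [← Finset.sum_neg_distrib, Finset.mul_sum]
        exact Finset.sum_congr rfl fun j _ => by ring
      rw [e]
      have h2 : θ * (R / (2 * √N) * √m) = m / 4 := by
        rw [hθ]
        calc √N * √m / (2 * R) * (R / (2 * √N) * √m) = (√m * √m) / 4 := by field_simp; norm_num
          _ = m / 4 := by rw [hm2]
      rw [← h2]
      gcongr
      linarith
    calc (N : ℝ) * m / 4 = ∑ _i : Fin N, (m : ℝ) / 4 := by simp; ring
      _ ≤ _ := Finset.sum_le_sum fun i _ => hi i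
  have h1 : (A.card : ℝ) * Real.exp (N * m / 4) ≤ 2 ^ (N * m) * Real.exp (N * m / 8) := by
    calc (A.card : ℝ) * Real.exp (N * m / 4) = ∑ _σ ∈ A, Real.exp (N * m / 4) := by simp
      _ ≤ _ := Finset.sum_le_sum hlow
      _ ≤ _ := Finset.sum_le_sum_of_subset_of_nonneg (Finset.subset_univ A)
          fun _ _ _ => (Real.exp_pos _).le
      _ ≤ _ := hup
      _ ≤ _ := by gcongr
  have h2 : Real.exp (N * m / 4) = Real.exp (N * m / 8) * Real.exp (N * m / 8) := by
    rw [← Real.exp_add]; ring_nf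
  rw [Real.exp_neg, ← div_eq_mul_inv, le_div_iff₀ (Real.exp_pos _)]
  rw [h2, ← mul_assoc] at h1
  exact le_of_mul_le_mul_right h1 (Real.exp_pos _)

/-- The minimizer over the ball of the maximum of the block vectors. -/
lemma exists_inner_signVec_eq (hN : 0 < N) (hm : 0 < m) {R : ℝ} (hR : 0 < R)
    (σ : Fin N → Fin m → Bool) :
    ∃ x : Eucl (N * m), ‖x‖ ≤ R ∧ ∀ i, inner ℝ (signVec i (σ i)) x = -(R / √N) := by
  have hN' : (0 : ℝ) < N := by exact_mod_cast hN
  have hm' : (0 : ℝ) < m := by exact_mod_cast hm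
  have hsN : 0 < √(N : ℝ) := Real.sqrt_pos.2 hN'
  have hsm : 0 < √(m : ℝ) := Real.sqrt_pos.2 hm'
  have hN2 : √(N : ℝ) * √(N : ℝ) = N := Real.mul_self_sqrt hN'.le
  have hm2 : √(m : ℝ) * √(m : ℝ) = m := Real.mul_self_sqrt hm'.le
  -- Every coordinate opposes its sign with size `R / √(N m)`, which gives norm exactly `R`.
  refine ⟨WithLp.toLp 2 fun c => -(R / (√N * √m)) *
    boolSign (σ (finProdFinEquiv.symm c).1 (finProdFinEquiv.symm c).2), ?_, fun i => ?_⟩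
  · apply le_of_sq_le_sq _ hR.le
    rw [EuclideanSpace.norm_sq_eq]
    have : ∀ c : Fin (N * m), ‖-(R / (√N * √m)) *
        boolSign (σ (finProdFinEquiv.symm c).1 (finProdFinEquiv.symm c).2)‖ ^ 2
        = R ^ 2 / (N * m) := by
      intro c
      rw [Real.norm_eq_abs, sq_abs, mul_pow, neg_sq, div_pow, mul_pow, pow_two √(N : ℝ),
        pow_two √(m : ℝ), hN2, hm2, pow_two (boolSign _), boolSign_mul_self, mul_one]
    simp only [this]
    rw [Finset.sum_const, Finset.card_univ, Fintype.card_fin, nsmul_eq_mul]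
    push_cast
    apply le_of_eq
    field_simp
  · rw [inner_signVec]
    have : ∀ j, boolSign (σ i j) * (-(R / (√N * √m)) * boolSign (σ i j)) = -(R / (√N * √m)) := by
      intro j
      linear_combination -(R / (√N * √m)) * boolSign_mul_self (σ i j)
    simp only [Equiv.symm_apply_apply, this]
    rw [Finset.sum_const, Finset.card_univ, Fintype.card_fin, nsmul_eq_mul]
    nth_rewrite 1 [← hm2]
    field_simp

end SignVectors

/-! ### The penalized lower bound: union bound, averaging over signs, choice of parameters. -/

section Penalized

variable {N m : ℕ}

/-- For a fixed seed and fixed samples, few sign patterns let the algorithm find a point at which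
every block vector is negatively correlated. -/
lemma card_filter_output_le (hN : 0 < N) (hm : 0 < m) (hNm : (N : ℝ) ≤ Real.exp m) {G R : ℝ}
    (hR : 0 < R) (k : (Fin N → Fin m → Bool) → Eucl (N * m) → Fin N) {Ξ : Type*}
    [MeasurableSpace Ξ] (A : Algorithm Ξ (Dom (N * m) R) (ℝ × Eucl (N * m))) {T : ℕ}
    (ω : Ξ × (Fin T → Sample)) :
    ((Finset.univ.filter fun σ : Fin N → Fin m → Bool => ∀ i, inner ℝ (signVec i (σ i))
      (A.output (firstOrderOracle (maxLoss G R (fun i => signVec i (σ i)) (k σ))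
        (maxLossGrad G (fun i => signVec i (σ i)) (k σ))) T ω : Eucl (N * m)) <
          -(R / (2 * √N))).card : ℝ) ≤
      2 ^ (N * m) * (32 / N * (∑ i, if ((ω.2 i : Sample) : ℝ) = 1 then 1 else 0)
        + Real.exp (-(N * m / 16))) := by
  classical
  have hN' : (0 : ℝ) < N := by exact_mod_cast hN
  have hm' : (0 : ℝ) < m := by exact_mod_cast hm
  set K : ℝ := ∑ i, if ((ω.2 i : Sample) : ℝ) = 1 then 1 else 0 with hK
  have hK0 : 0 ≤ K := Finset.sum_nonneg fun i _ => by split_ifs <;> simp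
  set O : (Fin N → Fin m → Bool) → Dom (N * m) R → Sample → ℝ × Eucl (N * m) := fun σ =>
    firstOrderOracle (maxLoss G R (fun i => signVec i (σ i)) (k σ))
      (maxLossGrad G (fun i => signVec i (σ i)) (k σ))
  let B : Sample → ℕ := fun s => if (s : ℝ) = 1 then N * 2 ^ m else 1
  have hB : ∀ (x : Dom (N * m) R) s, ∃ F : Finset (ℝ × Eucl (N * m)),
      F.card ≤ B s ∧ ∀ σ, O σ x s ∈ F := by
    intro x s
    by_cases hs : (s : ℝ) = 1
    -- An active answer is determined by the selected block and the signs on it.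
    · refine ⟨Finset.univ.image fun q : Fin N × (Fin m → Bool) =>
        (G * R / 2 + G / 4 * inner ℝ (signVec q.1 q.2) (x : Eucl (N * m)),
          (G / 4) • signVec q.1 q.2), Finset.card_image_le.trans (by simp [B, hs]), fun σ => ?_⟩
      refine Finset.mem_image.2 ⟨(k σ x, σ (k σ x)), Finset.mem_univ _, ?_⟩
      simp [O, firstOrderOracle, maxLoss, maxLossGrad, hs]
    · refine ⟨{(0, 0)}, by simp [B, hs], fun σ => ?_⟩
      simp [O, firstOrderOracle, maxLoss, maxLossGrad, hs]
  obtain ⟨F, hF, hmem⟩ := A.exists_finset_answers O B hB ω.1 T ω.2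
  have hprod : ((∏ i, B (ω.2 i) : ℕ) : ℝ) ≤ Real.exp (2 * m * K) := by
    rw [hK, Finset.mul_sum, Real.exp_sum]
    push_cast
    refine Finset.prod_le_prod (fun i _ => by positivity) fun i _ => ?_
    simp only [B]
    split_ifs
    · have h2 : (2 : ℝ) ^ m ≤ Real.exp m := by
        rw [← mul_one (m : ℝ), Real.exp_nat_mul]
        gcongr
        linarith [Real.add_one_le_exp (1 : ℝ)]
      calc ((N * 2 ^ m : ℕ) : ℝ) = N * 2 ^ m := by push_cast; ring
        _ ≤ Real.exp m * Real.exp m := by gcongr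
        _ = Real.exp (2 * m * 1) := by rw [← Real.exp_add]; ring_nf
    · simp
  -- For small `K` the `exp(2mK) ≤ exp(Nm/16)` transcripts are beaten by `exp(-Nm/8)`; otherwise `32
  -- K / N ≥ 1` and the bound is trivial.
  by_cases hKN : K ≤ N / 32
  · have hsub : (Finset.univ.filter fun σ : Fin N → Fin m → Bool => ∀ i,
        inner ℝ (signVec i (σ i)) (A.output (O σ) T ω : Eucl (N * m)) < -(R / (2 * √N))) ⊆
        F.biUnion fun h => Finset.univ.filter fun σ : Fin N → Fin m → Bool => ∀ i,
          inner ℝ (signVec i (σ i)) (A.point T ω.1 h : Eucl (N * m)) < -(R / (2 * √N)) := by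
      intro σ hσ
      rw [Finset.mem_biUnion]
      exact ⟨_, hmem σ, Finset.mem_filter.2 ⟨Finset.mem_univ _, (Finset.mem_filter.1 hσ).2⟩⟩
    have hcard : ((Finset.univ.filter fun σ : Fin N → Fin m → Bool => ∀ i,
        inner ℝ (signVec i (σ i)) (A.output (O σ) T ω : Eucl (N * m)) < -(R / (2 * √N))).card : ℝ)
        ≤ F.card * (2 ^ (N * m) * Real.exp (-(N * m / 8))) := by
      calc _ ≤ ((∑ h ∈ F, (Finset.univ.filter fun σ : Fin N → Fin m → Bool => ∀ i,
            inner ℝ (signVec i (σ i)) (A.point T ω.1 h : Eucl (N * m)) <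
              -(R / (2 * √N))).card : ℕ) : ℝ) := by
            exact_mod_cast (Finset.card_le_card hsub).trans Finset.card_biUnion_le
        _ ≤ ∑ _h ∈ F, (2 ^ (N * m) * Real.exp (-(N * m / 8)) : ℝ) := by
            push_cast
            exact Finset.sum_le_sum fun h _ => card_filter_inner_signVec_lt hN hm hR
              (mem_closedBall_zero_iff.1 (A.point T ω.1 h).2)
        _ = _ := by simp
    calc _ ≤ _ := hcard
      _ ≤ Real.exp (2 * m * K) * (2 ^ (N * m) * Real.exp (-(N * m / 8))) := by
          gcongr
          exact (Nat.cast_le.2 hF).trans hprod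
      _ ≤ Real.exp (N * m / 16) * (2 ^ (N * m) * Real.exp (-(N * m / 8))) := by
          gcongr
          nlinarith
      _ = 2 ^ (N * m) * Real.exp (-(N * m / 16)) := by
          rw [mul_left_comm, ← Real.exp_add]
          ring_nf
      _ ≤ _ := by
          gcongr
          have : 0 ≤ 32 / N * K := by positivity
          linarith
  · have h1 : 1 ≤ 32 / N * K := by
      rw [div_mul_eq_mul_div, one_le_div hN']
      linarith
    calc _ ≤ (2 : ℝ) ^ (N * m) := by
          have h := Finset.card_filter_le (Finset.univ : Finset (Fin N → Fin m → Bool))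
            fun σ => ∀ i, inner ℝ (signVec i (σ i)) (A.output (O σ) T ω : Eucl (N * m)) <
              -(R / (2 * √N))
          rw [Finset.card_univ, Fintype.card_fun, Fintype.card_fun, Fintype.card_bool,
            Fintype.card_fin, Fintype.card_fin, ← pow_mul, mul_comm m N] at h
          exact_mod_cast h
      _ = 2 ^ (N * m) * 1 := (mul_one _).symm
      _ ≤ _ := by
          gcongr
          have := Real.exp_pos (-(N * m / 16 : ℝ))
          linarith

lemma integral_count_active {Ξ : Type*} [MeasurableSpace Ξ] (ν : Measure Ξ)
    [IsProbabilityMeasure ν] {p : ℝ} (h0 : 0 ≤ p) (h1 : p ≤ 1) {a b : Sample} (ha : (a : ℝ) = 1)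
    (hb : (b : ℝ) ≠ 1) (T : ℕ) :
    ∫ ω : Ξ × (Fin T → Sample), (∑ i, if ((ω.2 i : Sample) : ℝ) = 1 then (1 : ℝ) else 0)
      ∂(ν.prod (Measure.pi fun _ : Fin T => twoPoint p a b)) = T * p := by
  have := isProbabilityMeasure_twoPoint h0 h1 a b
  set f : Sample → ℝ := fun s => if (s : ℝ) = 1 then 1 else 0 with hf
  have hfm : Measurable f := Measurable.ite
    (measurableSet_eq_fun measurable_subtype_coe measurable_const) measurable_const measurable_const
  have hi : ∀ i : Fin T, ∫ ω : Ξ × (Fin T → Sample), f (ω.2 i)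
      ∂(ν.prod (Measure.pi fun _ : Fin T => twoPoint p a b)) = p := by
    intro i
    have hmp := (measurePreserving_eval (fun _ : Fin T => twoPoint p a b) i).comp
      (measurePreserving_snd (μ := ν) (ν := Measure.pi fun _ : Fin T => twoPoint p a b))
    have h := integral_map (μ := ν.prod (Measure.pi fun _ : Fin T => twoPoint p a b))
      hmp.measurable.aemeasurable (f := f) hfm.aestronglyMeasurable
    rw [hmp.map_eq, integral_twoPoint h0 h1] at h
    simpa [hf, ha, hb] using h.symm
  rw [integral_finsetSum]
  · simp only [hf] at hi
    simp [hi]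
  · intro i _
    refine Integrable.of_bound (hfm.comp (by fun_prop)).aestronglyMeasurable 1
      (Filter.Eventually.of_forall fun ω => ?_)
    split_ifs <;> simp

lemma exists_chiSqPen_gap (hN : 0 < N) (hm : 0 < m) (hNm : (N : ℝ) ≤ Real.exp m)
    (hNm32 : 32 ≤ N * m) {G R ε lam p : ℝ} (hG : 0 < G) (hR : 0 < R) (hε : 0 < ε)
    (hεN : 32 * ε * √N ≤ G * R) (hlam : 0 < lam) (hp0 : 0 < p) (hp1 : p ≤ 1)
    (hp : p = 1 ∨ lam / p ≤ G * R / 4) {T : ℕ} (hT : 32 / N * (T * p) ≤ 1 / 4) {Ξ : Type u}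
    [MeasurableSpace Ξ] (ν : Measure Ξ) [IsProbabilityMeasure ν]
    (A : Algorithm Ξ (Dom (N * m) R) (ℝ × Eucl (N * m))) :
    ∃ P₀ : Measure Sample, IsProbabilityMeasure P₀ ∧
      ∃ ℓ : Eucl (N * m) → Sample → ℝ, IsLoss G R ℓ ∧
      ∃ g : Eucl (N * m) → Sample → Eucl (N * m), IsSubgradient R ℓ g ∧
        (∀ s, ∀ x ∈ Metric.closedBall (0 : Eucl (N * m)) R, ‖g x s‖ ≤ G) ∧
        ExpectedGapGT (ν.prod (Measure.pi fun _ : Fin T => P₀))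
          (fun x : Dom (N * m) R => chiSqPen lam P₀ (ℓ x))
          (A.output (firstOrderOracle ℓ g) T) ε := by
  classical
  have hN' : (0 : ℝ) < N := by exact_mod_cast hN
  have hm' : (0 : ℝ) < m := by exact_mod_cast hm
  have hsN : 0 < √(N : ℝ) := Real.sqrt_pos.2 hN'
  let w : (Fin N → Fin m → Bool) → Fin N → Eucl (N * m) := fun σ i => signVec i (σ i)
  have hw : ∀ σ i, ‖w σ i‖ ≤ 1 := fun σ i => norm_signVec_le hm i (σ i)
  choose k hk hmax using fun σ => exists_measurable_argmax hN (E := Eucl (N * m))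
    (h := fun i x => inner ℝ (w σ i) x) fun i => by fun_prop
  have hloss := fun σ => isLoss_maxLoss (R := R) hG (hw σ) (hk σ) (hmax σ)
  have hsub := fun σ => isSubgradient_maxLossGrad (R := R) hG (hk σ) (hmax σ)
  let a : Sample := ⟨1, by simp⟩
  let b : Sample := ⟨0, by simp⟩
  have hab : a ≠ b := by
    intro h
    have := congrArg Subtype.val h
    norm_num [a, b] at this
  have hP := isProbabilityMeasure_twoPoint hp0.le hp1 a b
  set μ := ν.prod (Measure.pi fun _ : Fin T => twoPoint p a b) with hμ
  let O : (Fin N → Fin m → Bool) → Dom (N * m) R → Sample → ℝ × Eucl (N * m) := fun σ =>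
    firstOrderOracle (maxLoss G R (w σ) (k σ)) (maxLossGrad G (w σ) (k σ))
  have hout : ∀ σ, Measurable (A.output (O σ) T : Ξ × (Fin T → Sample) → _) := fun σ =>
    A.measurable_output ((hloss σ).measurable.prodMk (hsub σ).measurable) T
  let bad : (Fin N → Fin m → Bool) → Set (Ξ × (Fin T → Sample)) := fun σ =>
    {ω | ∀ i, inner ℝ (w σ i) (A.output (O σ) T ω : Eucl (N * m)) < -(R / (2 * √N))}
  have hbadm : ∀ σ, MeasurableSet (bad σ) := by
    intro σ
    simp only [bad, ofPred_forall]
    refine MeasurableSet.iInter fun i => measurableSet_lt ?_ measurable_const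
    exact Measurable.inner measurable_const (measurable_subtype_coe.comp (hout σ))
  -- some sign pattern is found with probability at most one half
  obtain ⟨σ, hσ⟩ : ∃ σ, μ.real (bad σ) ≤ 1 / 2 := by
    have hsum : ∑ σ, μ.real (bad σ) ≤ ∑ _σ : Fin N → Fin m → Bool, (1 / 2 : ℝ) := by
      have hind : ∀ σ, μ.real (bad σ) = ∫ ω, (bad σ).indicator 1 ω ∂μ := fun σ =>
        (integral_indicator_one (hbadm σ)).symm
      have hii : ∀ σ, Integrable ((bad σ).indicator (1 : Ξ × (Fin T → Sample) → ℝ)) μ := fun σ =>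
        (integrable_const (1 : ℝ)).indicator (hbadm σ)
      simp only [hind]
      rw [← integral_finsetSum _ fun σ _ => hii σ]
      have hcount : Integrable (fun ω : Ξ × (Fin T → Sample) =>
          ∑ i, if ((ω.2 i : Sample) : ℝ) = 1 then (1 : ℝ) else 0) μ := by
        refine integrable_finsetSum _ fun i _ => ?_
        refine Integrable.of_bound (Measurable.ite (measurableSet_eq_fun (by fun_prop)
          measurable_const) measurable_const measurable_const).aestronglyMeasurable 1
          (Filter.Eventually.of_forall fun ω => ?_)
        split_ifs <;> simp
      -- Exchanging the sum over sign patterns with the expectation reduces to the count for a fixed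
      -- seed and fixed samples.
      have hle := integral_mono (integrable_finsetSum _ fun σ _ => hii σ)
        (((hcount.const_mul (32 / (N : ℝ))).add
          (integrable_const (Real.exp (-(N * m / 16))))).const_mul (2 ^ (N * m))) (fun ω => by
          have h := card_filter_output_le hN hm hNm (G := G) hR k A ω
          simp only [Pi.add_apply]
          refine le_trans (le_of_eq ?_) h
          rw [Finset.card_filter]
          push_cast
          refine Finset.sum_congr rfl fun σ _ => ?_
          simp only [indicator_apply, bad, mem_ofPred_eq, Pi.one_apply]
          rfl)
      refine hle.trans ?_
      simp only [Pi.add_apply]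
      rw [integral_const_mul, integral_add (hcount.const_mul _) (integrable_const _),
        integral_const_mul, integral_count_active ν hp0.le hp1 rfl (by simp [b]), integral_const,
        probReal_univ, one_smul, Finset.sum_const, Finset.card_univ, Fintype.card_fun,
        Fintype.card_fun, Fintype.card_bool, Fintype.card_fin, Fintype.card_fin, ← pow_mul,
        mul_comm m N, nsmul_eq_mul]
      push_cast
      gcongr
      have hexp : Real.exp (-(N * m / 16)) ≤ 1 / 4 := by
        have h32 : (32 : ℝ) ≤ N * m := by exact_mod_cast hNm32
        calc Real.exp (-(N * m / 16)) ≤ Real.exp (-(1 + 1)) := by gcongr; linarith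
          _ = (Real.exp 1 * Real.exp 1)⁻¹ := by rw [Real.exp_neg, Real.exp_add]
          _ ≤ (2 * 2)⁻¹ := by
            have := Real.add_one_le_exp (1 : ℝ)
            gcongr <;> linarith
          _ = 1 / 4 := by norm_num
      linarith
    obtain ⟨σ, -, h⟩ := Finset.exists_le_of_sum_le Finset.univ_nonempty hsum
    exact ⟨σ, h⟩
  refine ⟨twoPoint p a b, hP, _, hloss σ, _, hsub σ,
    fun s x _ => norm_maxLossGrad_le hG (hw σ) (k σ) x s, ?_⟩
  -- the objective is the maximum of the block vectors, up to a constant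
  set f : Eucl (N * m) → ℝ := fun x => inner ℝ (w σ (k σ x)) x with hf
  have hfm : Measurable f := ((measurable_of_countable (w σ)).comp (hk σ)).inner measurable_id
  have hfR : ∀ x : Dom (N * m) R, |f x| ≤ R := fun x =>
    (abs_real_inner_le_norm _ _).trans ((mul_le_of_le_one_left (norm_nonneg _) (hw σ _)).trans
      (mem_closedBall_zero_iff.1 x.2))
  set C : ℝ := G * R / 2 - lam * (1 - p) / (2 * p) with hC
  have hobj : ∀ x : Dom (N * m) R, chiSqPen lam (twoPoint p a b) (maxLoss G R (w σ) (k σ) x) =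
      C + G / 4 * f x := by
    intro x
    have ha : maxLoss G R (w σ) (k σ) x a = G * R / 2 + G / 4 * f x := by simp [maxLoss, a, hf]
    rw [chiSqPen_twoPoint hlam hp0 hp1 hab (by simp [maxLoss, b]), ha, hC]
    · ring
    · refine hp.imp_right fun h => h.trans ?_
      rw [ha]
      nlinarith [(abs_le.1 (hfR x)).1]
  have hbdd : BddBelow (range fun x : Dom (N * m) R => C + G / 4 * f x) := by
    refine ⟨C - G / 4 * R, ?_⟩
    rintro _ ⟨x, rfl⟩
    nlinarith [(abs_le.1 (hfR x)).1]
  unfold ExpectedGapGT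
  simp only [hobj]
  have hint : Integrable (fun ω => C + G / 4 * f (A.output (O σ) T ω)) μ := by
    refine Integrable.of_bound (((hfm.comp (measurable_subtype_coe.comp
      (hout σ))).const_mul _).const_add _).aestronglyMeasurable (|C| + G / 4 * R)
      (Filter.Eventually.of_forall fun ω => ?_)
    refine (norm_add_le _ _).trans ?_
    rw [Real.norm_eq_abs, Real.norm_eq_abs, abs_mul, abs_of_pos (by positivity : 0 < G / 4)]
    gcongr
    exact hfR _
  refine ⟨hint, ?_⟩
  set I := ⨅ x : Dom (N * m) R, C + G / 4 * f x with hI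
  obtain ⟨x0, hx0, hx0v⟩ := exists_inner_signVec_eq hN hm hR σ
  have hI0 : I ≤ C + G / 4 * -(R / √N) := by
    have h := ciInf_le hbdd ⟨x0, mem_closedBall_zero_iff.2 hx0⟩
    simp only [hf, w, hx0v] at h
    exact h
  -- Outside `bad σ` some block stays at `-R/(2√N)` or above, while the optimum is at most `-R/√N`;
  -- the factor `G / 4` turns the difference into `G R / (8 √N) ≥ 4 ε`.
  have hpt : ∀ ω, I + G * R / (8 * √N) * (bad σ)ᶜ.indicator 1 ω ≤
      C + G / 4 * f (A.output (O σ) T ω) := by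
    intro ω
    by_cases hω : ω ∈ bad σ
    · rw [indicator_of_notMem (by simpa using hω), mul_zero, add_zero]
      exact ciInf_le hbdd _
    · rw [indicator_of_mem (by simpa using hω), Pi.one_apply, mul_one]
      simp only [bad, mem_ofPred_eq, not_forall, not_lt] at hω
      obtain ⟨i, hi⟩ := hω
      have h1 := hi.trans (hmax σ _ i)
      have h2 : G / 4 * -(R / (2 * √N)) ≤ G / 4 * f (A.output (O σ) T ω) := by gcongr
      have h3 : G * R / (8 * √N) = G / 4 * (R / √N) - G / 4 * (R / (2 * √N)) := by
        field_simp; norm_num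
      linarith
  have hind : Integrable ((bad σ)ᶜ.indicator (1 : Ξ × (Fin T → Sample) → ℝ)) μ :=
    (integrable_const (1 : ℝ)).indicator (hbadm σ).compl
  have hmono := integral_mono ((integrable_const I).add (hind.const_mul (G * R / (8 * √N))))
    hint hpt
  simp only [Pi.add_apply] at hmono
  rw [integral_add (integrable_const I) (hind.const_mul _), integral_const_mul,
    integral_indicator_one (hbadm σ).compl, integral_const, probReal_univ, one_smul,
    probReal_compl_eq_one_sub (hbadm σ)] at hmono
  have h4 : 4 * ε ≤ G * R / (8 * √N) := by
    rw [le_div_iff₀ (by positivity)]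
    linarith
  have h5 : 4 * ε * (1 / 2) ≤ G * R / (8 * √N) * (1 - μ.real (bad σ)) := by
    gcongr
    linarith
  change ε < ∫ ω, C + G / 4 * f (A.output (O σ) T ω) ∂μ - I
  linarith

lemma chiSqPen_lower_bound {G R ε : ℝ} (hG : 0 < G) (hR : 0 < R) (hε : 0 < ε)
    (hεR : ε < G * R / 64) :
    ∃ d : ℕ, (d : ℝ) ≤ 3 * ((G * R) ^ 2 / ε ^ 2 * Real.log (G * R / ε)) ∧
      ∀ lam : ℝ, 0 < lam →
      ∀ T : ℕ, (T : ℝ) ≤ 2⁻¹ ^ 20 * ((G * R) ^ 2 / (lam / (G * R) * ε ^ 2)) →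
      ∀ (Ξ : Type u) [MeasurableSpace Ξ] (ν : Measure Ξ) [IsProbabilityMeasure ν]
        (A : Algorithm Ξ (Dom d R) (ℝ × Eucl d)),
      ∃ P₀ : Measure Sample, IsProbabilityMeasure P₀ ∧
      ∃ ℓ : Eucl d → Sample → ℝ, IsLoss G R ℓ ∧
      ∃ g : Eucl d → Sample → Eucl d, IsSubgradient R ℓ g ∧
        (∀ s, ∀ x ∈ Metric.closedBall (0 : Eucl d) R, ‖g x s‖ ≤ G) ∧
        ExpectedGapGT (ν.prod (Measure.pi fun _ : Fin T => P₀))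
          (fun x : Dom d R => chiSqPen lam P₀ (ℓ x)) (A.output (firstOrderOracle ℓ g) T) ε := by
  have hGR : 0 < G * R := by positivity
  set r := G * R / ε with hr
  have hr64 : 64 < r := by rw [hr, lt_div_iff₀ hε]; linarith
  have hr0 : 0 < r := by linarith
  have hlog : 4 < Real.log r := by
    have h1 : Real.log 64 < Real.log r := Real.log_lt_log (by norm_num) hr64
    have h2 : Real.log 64 = 6 * Real.log 2 := by
      rw [show (64 : ℝ) = 2 ^ 6 by norm_num, Real.log_pow]; norm_num
    linarith [Real.log_two_gt_d9]
  set y := (r / 32) ^ 2 with hy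
  have hy4 : 4 < y := by rw [hy]; nlinarith
  -- `N` is the largest block count with `32 ε √N ≤ G R`, and `m` ensures `N ≤ r² ≤ exp m`. Neither
  -- involves `lam`, which enters only through `p`.
  set N := ⌊y⌋₊ with hN
  set m := ⌈2 * Real.log r⌉₊ with hm
  have hN4 : 4 ≤ N := Nat.le_floor (by exact_mod_cast hy4.le)
  have hNy : (N : ℝ) ≤ y := Nat.floor_le (by linarith)
  have hyN : y < N + 1 := Nat.lt_floor_add_one y
  have hm8 : 8 ≤ m := by
    have h : (8 : ℝ) < m := lt_of_lt_of_le (by linarith) (Nat.le_ceil _)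
    exact_mod_cast h.le
  have hN0 : (0 : ℝ) < N := by
    have : 0 < N := by omega
    exact_mod_cast this
  have hm_le : (m : ℝ) ≤ 2 * Real.log r + 1 := (Nat.ceil_lt_add_one (by linarith)).le
  have hyr : y ≤ r ^ 2 := by rw [hy]; nlinarith
  refine ⟨N * m, ?_, fun lam hlam T hT Ξ _ ν _ A => ?_⟩
  · push_cast
    have e : (G * R) ^ 2 / ε ^ 2 = r ^ 2 := by rw [hr, div_pow]
    rw [e]
    calc (N : ℝ) * m ≤ r ^ 2 * (3 * Real.log r) := by
          gcongr
          · exact hNy.trans hyr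
          · linarith
      _ = _ := by ring
  -- Unless capped at `1`, this makes `lam / p` equal to `G R / 4`, the guaranteed lower bound for
  -- the active loss.
  · set p := min 1 (4 * lam / (G * R)) with hp
    have hp0 : 0 < p := lt_min one_pos (by positivity)
    refine exists_chiSqPen_gap (by omega) (by omega) ?_ (by nlinarith) hG hR hε ?_ hlam hp0
      (min_le_left _ _) ?_ ?_ ν A
    · calc (N : ℝ) ≤ r ^ 2 := hNy.trans hyr
        _ = Real.exp (2 * Real.log r) := by
          rw [← Real.exp_log hr0, Real.log_exp, ← Real.exp_nat_mul]; norm_num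
        _ ≤ Real.exp m := Real.exp_le_exp.2 (Nat.le_ceil _)
    · have h : √(N : ℝ) ≤ r / 32 := Real.sqrt_le_iff.2 ⟨by positivity, hNy⟩
      calc 32 * ε * √N ≤ 32 * ε * (r / 32) := by gcongr
        _ = G * R := by rw [hr]; field_simp
    · rcases min_choice 1 (4 * lam / (G * R)) with h | h
      · exact Or.inl h
      · right
        rw [hp, h]
        apply le_of_eq
        field_simp
    · calc 32 / (N : ℝ) * (T * p) ≤ 32 / N * (2⁻¹ ^ 20 * ((G * R) ^ 2 / (lam / (G * R) * ε ^ 2))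
            * (4 * lam / (G * R))) := by
            gcongr
            exact min_le_right _ _
        _ = 32 / N * (2⁻¹ ^ 18 * (1024 * y)) := by
            rw [hy, hr]; field_simp; norm_num
        _ ≤ 32 / N * (2⁻¹ ^ 18 * (1024 * (2 * N))) := by
            gcongr
            linarith
        _ = 1 / 4 := by field_simp; norm_num

end Penalized

end

theorem theorem3 :
    ∃ c C : ℝ, 0 < c ∧ 0 < C ∧
    -- conditional value at risk, first-order oracle, every dimension
    (∀ G R α ε : ℝ, 0 < G → 0 < R → 0 < α → α ≤ 1 → 0 < ε → ε < G * R / 64 →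
      ∀ d : ℕ, 1 ≤ d →
      ∃ ℓ : Eucl d → Sample → ℝ, IsLoss G R ℓ ∧ (∃ g, IsSubgradient R ℓ g) ∧
        ∀ g : Eucl d → Sample → Eucl d, IsSubgradient R ℓ g →
        ∀ T : ℕ, (T : ℝ) ≤ c * ((G * R) ^ 2 / (α * ε ^ 2)) →
        ∀ (Ξ : Type u) [MeasurableSpace Ξ] (ν : Measure Ξ) [IsProbabilityMeasure ν]
          (A : Algorithm Ξ (Dom d R) (ℝ × Eucl d)),
        ∃ P₀ : Measure Sample, IsProbabilityMeasure P₀ ∧ IsTwoPoint P₀ ∧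
          ExpectedGapGT (ν.prod (Measure.pi fun _ : Fin T => P₀))
            (fun x : Dom d R => cvar α P₀ (ℓ x)) (A.output (firstOrderOracle ℓ g) T) ε) ∧
    -- conditional value at risk, dimension one, the loss `x * s`, samples fully observed
    (∀ G R α ε : ℝ, 0 < G → 0 < R → 0 < α → α ≤ 1 → 0 < ε → ε < G * R / 64 →
      ∀ n : ℕ, (n : ℝ) ≤ (G * R) ^ 2 / (2048 * α * ε ^ 2) →
      ∀ (Ξ : Type u) [MeasurableSpace Ξ] (ν : Measure Ξ) [IsProbabilityMeasure ν]
        (xhat : Ξ × (Fin n → Icc (-G) G) → Icc (-R) R), Measurable xhat →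
      ∃ P₀ : Measure (Icc (-G) G), IsProbabilityMeasure P₀ ∧ IsTwoPoint P₀ ∧
        ExpectedGapGT (ν.prod (Measure.pi fun _ : Fin n => P₀))
          (fun x : Icc (-R) R => cvar α P₀ fun s => (x : ℝ) * (s : ℝ)) xhat ε) ∧
    -- penalized chi-square objective, first-order oracle
    (∀ G R ε : ℝ, 0 < G → 0 < R → 0 < ε → ε < G * R / 64 →
      ∃ d : ℕ, (d : ℝ) ≤ C * ((G * R) ^ 2 / ε ^ 2 * Real.log (G * R / ε)) ∧
        ∀ lam : ℝ, 0 < lam →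
        ∀ T : ℕ, (T : ℝ) ≤ c * ((G * R) ^ 2 / (lam / (G * R) * ε ^ 2)) →
        ∀ (Ξ : Type u) [MeasurableSpace Ξ] (ν : Measure Ξ) [IsProbabilityMeasure ν]
          (A : Algorithm Ξ (Dom d R) (ℝ × Eucl d)),
        ∃ P₀ : Measure Sample, IsProbabilityMeasure P₀ ∧
        ∃ ℓ : Eucl d → Sample → ℝ, IsLoss G R ℓ ∧
        ∃ g : Eucl d → Sample → Eucl d, IsSubgradient R ℓ g ∧
          (∀ s, ∀ x ∈ Metric.closedBall (0 : Eucl d) R, ‖g x s‖ ≤ G) ∧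
          ExpectedGapGT (ν.prod (Measure.pi fun _ : Fin T => P₀))
            (fun x : Dom d R => chiSqPen lam P₀ (ℓ x)) (A.output (firstOrderOracle ℓ g) T) ε) := by
  -- The constant `2⁻¹ ^ 20` is dictated by the penalized bound, where `y ≤ 2 N` turns `32 T p / N`
  -- into at most `1/4`; the CVaR bound has room to spare.
  refine ⟨2⁻¹ ^ 20, 3, by norm_num, by norm_num, ?_, ?_, ?_⟩
  · intro G R α ε hG hR hα hα1 hε hεR d hd
    exact cvar_lower_bound_oracle hG hR hα hα1 hε hεR hd
  · intro G R α ε hG hR hα hα1 hε hεR n hn Ξ _ ν _ xhat hx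
    exact cvar_lower_bound_samples hG hR hα hα1 hε hεR hn ν hx
  · intro G R ε hG hR hε hεR
    exact chiSqPen_lower_bound hG hR hε hεR
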